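/- Let $(X,\mathcal A,m)$ be a $\sigma$-finite measure space and $\mathcal E$ a symmetric Dirichlet form in the real space $L^2=L^2(X,m)$ with domain $\mathcal D$: a densely defined, closed, nonnegative quadratic form such that $u\in\mathcal D$ implies $u_{0,1}:=\min(\max(u,0),1)\in\mathcal D$ and $\mathcal E[u_{0,1}]\le\mathcal E[u]$. Let $(K_\beta)_{\beta>0}$ and $(T_t)_{t>0}$ be its resolvent and semigroup, and let $\mathcal E^{(t)}$ and $\mathcal E^{(\beta)}$ be the approximating Dirichlet forms, both with domain $L^2$, $$\mathcal E^{(t)}[u]=\tfrac1t\,(u-T_tu,u)\quad(t>0),\qquad \mathcal E^{(\beta)}[u]=\beta\,(u-\beta K_\beta u,u)\quad(\beta>0).$$ For a Dirichlet form $\mathcal F$ in $L^2$ with semigroup $(S_s)_{s>0}$, extended to $L^\infty$ by monotone limits, put $X_{\rm cons}(\mathcal F)=\bigcap_{s>0}\{S_s1=1\}$ (a set defined up to null sets; as $S_s1$ decreases in $s$, it suffices to intersect over $s\in\{1,2,\dots\}$) and $X_{\rm diss}(\mathcal F)=X\setminus X_{\rm cons}(\mathcal F)$. Both sets are $\mathcal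 F$-invariant. The conservative part $\mathcal F^{\rm cons}$ and the dissipative part $\mathcal F^{\rm diss}$ are the forms $\mathcal F^{Y}$ with $Y=X_{\rm cons}(\mathcal F)$ and $Y=X_{\rm diss}(\mathcal F)$ respectively, where $\mathcal F^Y[u]=\mathcal F[1_Yu]$ is regarded as a Dirichlet form in $L^2(Y,m|_Y)$. Identifying $L^2(Y,m|_Y)$ with the closed subspace $\{u\in L^2: u=0\text{ a.e. on }X\setminus Y\}$, this means $\mathcal F^Y[u]=\mathcal F[u]$ for all $u$ in the domain of $\mathcal F$ with $u=0$ a.e. on $X\setminus Y$, and $\mathcal F^Y[u]=+\infty$ for all other $u\in L^2$. A sequence $(F_n)$ of functionals on a Hilbert space $H$ with values in $(-\infty,+\infty]$ Mosco-converges to $F$ if (M1) $F[u]\le\liminf_n F_n[u_n]$ whenever $u_n\to u$ weakly in $H$, and (M2) for every $u\in H$ there are $u_n\to u$ strongly in $H$ with $\limsup_nF_n[u_n]\le F[u]$. Then, for all $t,\beta>0$, the sets $X_{\rm cons}(\mathcal E)$, $X_{\rm cons}(\mathcal E^{(t)})$ and $X_{\rm cons}(\mathcal E^{(\beta)})$ coincide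 up to null sets, and so do $X_{\rm diss}(\mathcal E)$, $X_{\rm diss}(\mathcal E^{(t)})$ and $X_{\rm diss}(\mathcal E^{(\beta)})$, so that the respective parts are forms in the same spaces. Moreover: 1. for every sequence $t_n>0$ with $t_n\to0$, the conservative parts of $\mathcal E^{(t_n)}$ Mosco-converge to the conservative part of $\mathcal E$, and the dissipative parts of $\mathcal E^{(t_n)}$ Mosco-converge to the dissipative part of $\mathcal E$; 2. for every sequence $\beta_n>0$ with $\beta_n\to\infty$, the conservative parts of $\mathcal E^{(\beta_n)}$ Mosco-converge to the conservative part of $\mathcal E$, and the dissipative parts of $\mathcal E^{(\beta_n)}$ Mosco-converge to the dissipative part of $\mathcal E$. -/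

import Mathlib

open MeasureTheory Filter Topology

noncomputable section

namespace DirichletParts

/-- The real Hilbert space `L²(X, m)`. -/
abbrev L2 {X : Type*} [MeasurableSpace X] (m : Measure X) : Type _ := Lp ℝ 2 m

/-- A bilinear form `E(u, v)` defined on a linear subspace of `L²(X, m)`; the associated quadratic
form is `E[u] = E(u, u)`. -/
structure L2Form {X : Type*} [MeasurableSpace X] (m : Measure X) where
  /-- the domain of the form -/
  domain : Submodule ℝ (L2 m)
  /-- the bilinear form -/
  bilin : domain →ₗ[ℝ] domain →ₗ[ℝ] ℝ

namespace L2Form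

variable {X : Type*} [MeasurableSpace X] {m : Measure X}

/-- `E₁[u] = E[u] + ‖u‖²`. -/
def energyOne (E : L2Form m) (u : E.domain) : ℝ := E.bilin u u + ‖(u : L2 m)‖ ^ 2

/-- Symmetric Dirichlet forms: densely defined, closed, nonnegative symmetric forms on which the
unit contraction `u ↦ min (max u 0) 1` operates. -/
structure IsDirichletForm (E : L2Form m) : Prop where
  symm : ∀ u v : E.domain, E.bilin u v = E.bilin v u
  nonneg : ∀ u : E.domain, 0 ≤ E.bilin u u
  dense : Dense (E.domain : Set (L2 m))
  /-- every `E₁`-Cauchy sequence in the domain is `E₁`-convergent -/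
  closed : ∀ u : ℕ → E.domain,
    (∀ ε : ℝ, 0 < ε → ∃ N : ℕ, ∀ k ≥ N, ∀ l ≥ N, E.energyOne (u k - u l) < ε) →
    ∃ v : E.domain, Tendsto (fun n => E.energyOne (u n - v)) atTop (𝓝 0)
  markov : ∀ u : E.domain, ∃ w : E.domain,
    (((w : L2 m) : X → ℝ) =ᵐ[m] fun x => min (max (((u : L2 m) : X → ℝ) x) 0) 1) ∧
    E.bilin w w ≤ E.bilin u u

/-- The quadratic form `E[u]`, extended by `+∞` off its domain. -/
def value (E : L2Form m) (u : L2 m) : EReal :=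
  open Classical in if h : u ∈ E.domain then ((E.bilin ⟨u, h⟩ ⟨u, h⟩ : ℝ) : EReal) else ⊤

/-- `K` is the `β`-resolvent of `E`:
`K f ∈ dom E` and `E(K f, v) + β (K f, v) = (f, v)` for all `v ∈ dom E`. -/
def IsResolvent (E : L2Form m) (β : ℝ) (K : L2 m →L[ℝ] L2 m) : Prop :=
  ∀ f : L2 m, ∃ h : K f ∈ E.domain, ∀ v : E.domain,
    E.bilin ⟨K f, h⟩ v + β * inner ℝ (K f) (v : L2 m) = inner ℝ f (v : L2 m)

/-- The resolvent `K_β` of `E`. (For a Dirichlet form and `β > 0` the operator exists and is unique,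
by the Riesz representation theorem.) -/
def resolvent (E : L2Form m) (β : ℝ) : L2 m →L[ℝ] L2 m :=
  open Classical in if h : ∃ K, E.IsResolvent β K then h.choose else 0

/-- `T` is the time-`t` operator of the semigroup of `E`, by the Hille–Yosida construction:
`T f = lim_{β → ∞} exp (t β (β K_β - 1)) f` for all `f ∈ L²`. -/
def IsSemigroupAt (E : L2Form m) (t : ℝ) (T : L2 m →L[ℝ] L2 m) : Prop :=
  ∀ f : L2 m, Tendsto
    (fun β : ℝ => (NormedSpace.exp ((t * β) • (β • E.resolvent β - 1)) : L2 m →L[ℝ] L2 m) f)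
    atTop (𝓝 (T f))

/-- The operator `T_t` of the semigroup of `E`. (For a Dirichlet form and `t > 0` it exists and is
unique, by the Hille–Yosida theorem.) -/
def semigroup (E : L2Form m) (t : ℝ) : L2 m →L[ℝ] L2 m :=
  open Classical in if h : ∃ T, E.IsSemigroupAt t T then h.choose else 0

/-- The everywhere defined form `(u, v) ↦ (A u, v)` of a bounded operator `A`. -/
def ofOperator (A : L2 m →L[ℝ] L2 m) : L2Form m where
  domain := ⊤
  bilin := ((innerₗ (L2 m)).comp A.toLinearMap).domRestrict₁₂ ⊤ ⊤

/-- The time dependent approximation `E^{(t)}[u] = t⁻¹ (u - T_t u, u)`, with domain `L²`. -/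
def timeApprox (E : L2Form m) (t : ℝ) : L2Form m :=
  ofOperator (t⁻¹ • (1 - E.semigroup t))

/-- The Deny–Yosida approximation `E^{(β)}[u] = β (u - β K_β u, u)`, with domain `L²`. -/
def yosidaApprox (E : L2Form m) (β : ℝ) : L2Form m :=
  ofOperator (β • (1 - β • E.resolvent β))

/-- The function `T_t 1`, where `T_t` is extended from `L²` to `L^∞` by monotone limits:
`T_t 1 = sup_k T_t 1_{S_k}` for sets `S_k ↑ X` of finite measure
(up to null sets it does not depend on these sets, and the supremum is a limit). -/
def semigroupOne [SigmaFinite m] (E : L2Form m) (t : ℝ) (x : X) : EReal :=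
  ⨆ k : ℕ, (((E.semigroup t
    (indicatorConstLp 2 (measurableSet_spanningSets m k) (measure_spanningSets_lt_top m k).ne
      (1 : ℝ)) : L2 m) : X → ℝ) x : EReal)

/-- The conservative space `X_cons = ⋂_{t > 0} {T_t 1 = 1}`. Each `T_t 1` being defined up to a null
set and decreasing in `t`, the intersection is taken over the times `t = 1, 2, 3, …`. -/
def consSpace [SigmaFinite m] (E : L2Form m) : Set X :=
  ⋂ k : ℕ, {x | E.semigroupOne ((k : ℝ) + 1) x = 1}

/-- The dissipative space `X_diss = X \ X_cons`. -/
def dissSpace [SigmaFinite m] (E : L2Form m) : Set X := E.consSpaceᶜ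

/-- The part `E^Y` of `E` on an invariant set `Y`, as a form in `L²(Y, m|_Y)`, where `L²(Y, m|_Y)`
is the closed subspace of those elements of `L²(X, m)` that vanish a.e. off `Y`:
`E^Y[u] = E[u] = E[1_Y u]` if `u ∈ dom E` vanishes a.e. off `Y` (equivalently, by invariance, if
`u = 1_Y w` with `w ∈ dom E`), and `+∞` otherwise. -/
def part (E : L2Form m) (Y : Set X) (u : L2 m) : EReal :=
  open Classical in if ∀ᵐ x ∂m, x ∉ Y → (u : X → ℝ) x = 0 then E.value u else ⊤

/-- The conservative part of `E`. -/
def consPart [SigmaFinite m] (E : L2Form m) : L2 m → EReal := E.part E.consSpace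

/-- The dissipative part of `E`. -/
def dissPart [SigmaFinite m] (E : L2Form m) : L2 m → EReal := E.part E.dissSpace

end L2Form

/-- Mosco convergence of a sequence of `(-∞, +∞]`-valued functionals on a real Hilbert space. -/
structure MoscoConverges {H : Type*} [NormedAddCommGroup H] [InnerProductSpace ℝ H]
    (F : ℕ → H → EReal) (G : H → EReal) : Prop where
  /-- lower bound along weakly convergent sequences -/
  liminf_ge : ∀ (u : ℕ → H) (v : H),
    (∀ w : H, Tendsto (fun n => inner ℝ (u n) w) atTop (𝓝 (inner ℝ v w))) →
    G v ≤ liminf (fun n => F n (u n)) atTop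
  /-- strongly convergent recovery sequences -/
  exists_recovery : ∀ v : H, ∃ u : ℕ → H, Tendsto u atTop (𝓝 v) ∧
    limsup (fun n => F n (u n)) atTop ≤ G v

end DirichletParts

end

/-! The theorem splits into two independent facts.

Mosco convergence. Both families of bounded forms increase pointwise to `E`, with supremum `+∞`
exactly off the domain. For `E^(β)` this follows from the variational formula `E^(β)[u] = min_v
(E[v] + β ‖u - v‖²)`, attained at `v = β K_β u` (`yosida_add_eq`, `mem_domain_of_yosida_le`). For
`E^(t)` it follows from convexity of `s ↦ (T_s u, u)` and from writing `E^(β)` as a Laplace average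
of the time energies (`timeEnergy_antitone`, `mem_domain_of_timeEnergy_le`). For increasing forms a
constant sequence is a recovery sequence, and the lower bound comes from weak lower semicontinuity
of each approximation. Both survive restriction to the closed subspace of functions supported on any
set `Y` (`moscoConverges_part`); invariance of `Y` plays no role.

Equality of the spaces. By symmetry, `T_s 1 = 1` a.e. on a set `B` of finite measure iff `T_s`
preserves the integral of `1_B` (`iSup_eq_one_iff_hasMass`). The form `c (u - P u, u)` has semigroup
`exp (s c (P - 1))`, a Poisson average of the powers of `P` with strictly positive weights. No power
increases mass, so the average preserves it iff every power does (`hasMass_exp_smul_sub_one_iff`).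
For `P = T_t` the powers are `T_{nt}`, and mass decreases in time. For `P = β K_β`, an exponential
average of the `T_r`, preservation of mass forces it for almost every `r`, hence for all
(`hasMass_semigroup_of_resolvent`); the converse uses that `K_β` and `T_r` commute. -/

namespace DirichletParts

/-! ### Exponentials of bounded operators -/

section BoundedGenerators

variable {H : Type*} [NormedAddCommGroup H] [InnerProductSpace ℝ H]

theorem norm_pow_apply_le {P : H →L[ℝ] H} (hP : ∀ f, ‖P f‖ ≤ ‖f‖) (n : ℕ) (f : H) :
    ‖(P ^ n) f‖ ≤ ‖f‖ := by
  induction n with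
  | zero => simp
  | succ n ih => rw [pow_succ']; exact (hP _).trans ih

variable [CompleteSpace H]

theorem exp_add_smul (A : H →L[ℝ] H) (s t : ℝ) :
    NormedSpace.exp ((s + t) • A) = NormedSpace.exp (s • A) * NormedSpace.exp (t • A) := by
  let _ : NormedAlgebra ℚ (H →L[ℝ] H) := NormedAlgebra.restrictScalars ℚ ℝ _
  rw [add_smul]
  exact NormedSpace.exp_add_of_commute (((Commute.refl A).smul_left s).smul_right t)

theorem hasSum_exp_smul_apply (P : H →L[ℝ] H) (x : ℝ) (f : H) :
    HasSum (fun n : ℕ => (x ^ n / n.factorial) • (P ^ n) f) (NormedSpace.exp (x • P) f) := by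
  have h := (NormedSpace.exp_series_hasSum_exp' (𝕂 := ℝ) (x • P)).mapL
    (ContinuousLinearMap.apply ℝ H f)
  convert! h using 2 with n
  simp [smul_pow, smul_smul, div_eq_inv_mul]

theorem exp_smul_sub_one (P : H →L[ℝ] H) (x : ℝ) :
    NormedSpace.exp (x • (P - 1)) = Real.exp (-x) • NormedSpace.exp (x • P) := by
  let _ : NormedAlgebra ℚ (H →L[ℝ] H) := NormedAlgebra.restrictScalars ℚ ℝ _
  have h1 : x • (P - 1) = algebraMap ℝ (H →L[ℝ] H) (-x) + x • P := by
    rw [Algebra.algebraMap_eq_smul_one, smul_sub, neg_smul]; abel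
  rw [h1, NormedSpace.exp_add_of_commute (Algebra.commute_algebraMap_left _ _),
    ← NormedSpace.algebraMap_exp_comm, ← Real.exp_eq_exp_ℝ, Algebra.algebraMap_eq_smul_one,
    smul_mul_assoc, one_mul]

/-- The exponential becomes a Poisson average of the powers of `P`. For `x ≥ 0` the weights are
nonnegative with sum one, so contractivity, the Markov property and statements about mass pass
through it. -/
theorem hasSum_exp_smul_sub_one_apply (P : H →L[ℝ] H) (x : ℝ) (f : H) :
    HasSum (fun n : ℕ => (Real.exp (-x) * (x ^ n / n.factorial)) • (P ^ n) f)
      (NormedSpace.exp (x • (P - 1)) f) := by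
  rw [exp_smul_sub_one]
  simpa [mul_smul] using (hasSum_exp_smul_apply P x f).const_smul (Real.exp (-x))

theorem hasSum_poissonWeight (x : ℝ) :
    HasSum (fun n : ℕ => Real.exp (-x) * (x ^ n / n.factorial)) 1 := by
  have h := (NormedSpace.expSeries_div_hasSum_exp x).mul_left (Real.exp (-x))
  rwa [← Real.exp_eq_exp_ℝ, ← Real.exp_add, neg_add_cancel, Real.exp_zero] at h

theorem norm_exp_smul_sub_one_apply_le {P : H →L[ℝ] H} (hP : ∀ f, ‖P f‖ ≤ ‖f‖) {x : ℝ}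
    (hx : 0 ≤ x) (f : H) : ‖NormedSpace.exp (x • (P - 1)) f‖ ≤ ‖f‖ := by
  have h := (hasSum_poissonWeight x).mul_right ‖f‖
  rw [one_mul] at h
  refine (hasSum_exp_smul_sub_one_apply P x f).norm_le_of_bounded h fun n => ?_
  rw [norm_smul, Real.norm_of_nonneg (by positivity)]
  exact mul_le_mul_of_nonneg_left (norm_pow_apply_le hP n f) (by positivity)

theorem hasDerivAt_exp_smul_apply (A : H →L[ℝ] H) (f : H) (s : ℝ) :
    HasDerivAt (fun r : ℝ => NormedSpace.exp (r • A) f) (NormedSpace.exp (s • A) (A f)) s := by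
  have h := (hasDerivAt_exp_smul_const (𝕂 := ℝ) A s).clm_apply (hasDerivAt_const s f)
  simpa using h

/-- Duhamel's argument: the path `r ↦ exp (r A) exp ((t - r) B) f` joins the two vectors, and since
`A` and `B` commute its velocity is `exp (r A) exp ((t - r) B) (A f - B f)`. -/
theorem norm_exp_sub_exp_apply_le {A B : H →L[ℝ] H} (hAB : Commute A B)
    (hA : ∀ s : ℝ, 0 ≤ s → ∀ f, ‖NormedSpace.exp (s • A) f‖ ≤ ‖f‖)
    (hB : ∀ s : ℝ, 0 ≤ s → ∀ f, ‖NormedSpace.exp (s • B) f‖ ≤ ‖f‖) {t : ℝ} (ht : 0 ≤ t) (f : H) :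
    ‖NormedSpace.exp (t • A) f - NormedSpace.exp (t • B) f‖ ≤ t * ‖A f - B f‖ := by
  let _ : NormedAlgebra ℚ (H →L[ℝ] H) := NormedAlgebra.restrictScalars ℚ ℝ _
  have hd : ∀ s : ℝ, HasDerivAt
      (fun r : ℝ => NormedSpace.exp (r • A) (NormedSpace.exp ((t - r) • B) f))
      (NormedSpace.exp (s • A) (NormedSpace.exp ((t - s) • B) (A f - B f))) s := by
    intro s
    have h1 : HasDerivAt (fun r : ℝ => NormedSpace.exp ((t - r) • B) f)
        (-(NormedSpace.exp ((t - s) • B) (B f))) s := by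
      have := (hasDerivAt_exp_smul_apply B f (t - s)).scomp s ((hasDerivAt_id s).const_sub t)
      simpa [Function.comp_def] using this
    have h2 := (hasDerivAt_exp_smul_const (𝕂 := ℝ) A s).clm_apply h1
    convert! h2 using 1
    have hc : Commute A (NormedSpace.exp ((t - s) • B)) := (hAB.smul_right _).exp_right
    have hc' : A (NormedSpace.exp ((t - s) • B) f) = NormedSpace.exp ((t - s) • B) (A f) :=
      congrArg (fun L : H →L[ℝ] H => L f) hc.eq
    simp [hc']
    abel
  have h := norm_image_sub_le_of_norm_deriv_le_segment' (a := 0) (b := t)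
    (fun s _ => (hd s).hasDerivWithinAt) (C := ‖A f - B f‖)
    (fun s hs => (hA s hs.1 _).trans (hB _ (by linarith [hs.2]) _)) t ⟨ht, le_rfl⟩
  simpa [mul_comm] using h

/-- `s ↦ (exp (s A) f, f)` is convex for selfadjoint `A`. -/
theorem convexOn_inner_exp_smul_apply {A : H →L[ℝ] H} (hA : IsSelfAdjoint A) (f : H) :
    ConvexOn ℝ Set.univ fun s : ℝ => inner ℝ (NormedSpace.exp (s • A) f) f := by
  have hd : ∀ (g : H) (s : ℝ), HasDerivAt (fun r : ℝ => inner ℝ (NormedSpace.exp (r • A) g) f)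
      (inner ℝ (NormedSpace.exp (s • A) (A g)) f) s := by
    intro g s
    simpa using (hasDerivAt_exp_smul_apply A g s).inner ℝ (hasDerivAt_const s f)
  have hderiv : ∀ g : H, deriv (fun r : ℝ => inner ℝ (NormedSpace.exp (r • A) g) f) =
      fun r => inner ℝ (NormedSpace.exp (r • A) (A g)) f := fun g => funext fun s => (hd g s).deriv
  refine convexOn_univ_of_deriv2_nonneg (fun s => (hd f s).differentiableAt) ?_ fun s => ?_
  · rw [hderiv]; exact fun s => (hd _ s).differentiableAt
  · rw [Function.iterate_succ_apply, Function.iterate_one, hderiv, hderiv]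
    -- Splitting the exponential into two selfadjoint halves turns the second derivative `(exp (s A)
    -- A² f, f)` into `‖exp ((s / 2) A) A f‖²`.
    have hs : NormedSpace.exp (s • A) =
        NormedSpace.exp ((s / 2) • A) * NormedSpace.exp ((s / 2) • A) := by
      rw [← exp_add_smul, add_halves]
    have hsa : IsSelfAdjoint (NormedSpace.exp ((s / 2) • A)) :=
      ((IsSelfAdjoint.all (s / 2)).smul hA).exp
    have hc : A * NormedSpace.exp ((s / 2) • A) = NormedSpace.exp ((s / 2) • A) * A :=
      ((Commute.refl A).smul_right (s / 2)).exp_right.eq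
    have hc' : ∀ g, A (NormedSpace.exp ((s / 2) • A) g) = NormedSpace.exp ((s / 2) • A) (A g) :=
      fun g => congrArg (fun L : H →L[ℝ] H => L g) hc
    have key : inner ℝ (NormedSpace.exp (s • A) (A (A f))) f =
        inner ℝ (NormedSpace.exp ((s / 2) • A) (A f)) (NormedSpace.exp ((s / 2) • A) (A f)) := by
      rw [hs, mul_apply_eq_comp, ← hc', ← hc']
      rw [← ContinuousLinearMap.adjoint_inner_right, ← ContinuousLinearMap.star_eq_adjoint,
        hA.star_eq]
      rw [← hc', ← ContinuousLinearMap.adjoint_inner_right, ← ContinuousLinearMap.star_eq_adjoint,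
        hsa.star_eq, hc']
    exact (real_inner_self_nonneg (x := NormedSpace.exp ((s / 2) • A) (A f))).trans_eq key.symm

/-- The difference quotients of `s ↦ (exp (s A) f, f)` at `0` are ordered. -/
theorem inner_sub_exp_smul_apply_antitone {A : H →L[ℝ] H} (hA : IsSelfAdjoint A) (f : H) {s t : ℝ}
    (hs : 0 < s) (hst : s ≤ t) :
    t⁻¹ * inner ℝ (f - NormedSpace.exp (t • A) f) f ≤
      s⁻¹ * inner ℝ (f - NormedSpace.exp (s • A) f) f := by
  have ht := hs.trans_le hst
  have h := (convexOn_inner_exp_smul_apply hA f).2 (Set.mem_univ 0) (Set.mem_univ t)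
    (show 0 ≤ 1 - s / t by rw [sub_nonneg, div_le_one ht]; exact hst)
    (show 0 ≤ s / t by positivity) (by ring)
  have e : (1 - s / t) • (0 : ℝ) + (s / t) • t = s := by
    simp only [smul_eq_mul]; field_simp; ring
  rw [e] at h
  simp only [smul_eq_mul, zero_smul, NormedSpace.exp_zero, one_apply_eq_self] at h
  rw [inner_sub_left, inner_sub_left, inv_mul_le_iff₀ ht, ← mul_assoc, ← div_eq_mul_inv,
    div_mul_eq_mul_div, le_div_iff₀ hs]
  have h2 := mul_le_mul_of_nonneg_right h ht.le
  have e2 : ((1 - s / t) * inner ℝ f f + s / t * inner ℝ (NormedSpace.exp (t • A) f) f) * t =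
    (t - s) * inner ℝ f f + s * inner ℝ (NormedSpace.exp (t • A) f) f := by field_simp
  rw [e2] at h2
  linarith

/-- The right side is the derivative of `s ↦ (f - exp (s A) f, f)` at `0`, to which the ordered
difference quotients increase as `s` decreases to `0`. -/
theorem inner_sub_exp_smul_apply_le {A : H →L[ℝ] H} (hA : IsSelfAdjoint A) (f : H) {t : ℝ}
    (ht : 0 < t) :
    t⁻¹ * inner ℝ (f - NormedSpace.exp (t • A) f) f ≤ - inner ℝ (A f) f := by
  have hd : HasDerivAt (fun r : ℝ => inner ℝ (f - NormedSpace.exp (r • A) f) f)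
      (- inner ℝ (A f) f) 0 := by
    have h1 := (hasDerivAt_exp_smul_apply A f 0).const_sub f
    simpa using h1.inner ℝ (hasDerivAt_const (0 : ℝ) f)
  have h := (hasDerivAt_iff_tendsto_slope.1 hd).mono_left
    (nhdsWithin_mono (0 : ℝ) (s := Set.Ioi 0) fun x (hx : 0 < x) => hx.ne')
  refine ge_of_tendsto h ?_
  filter_upwards [Ioc_mem_nhdsGT ht] with s hs
  have := inner_sub_exp_smul_apply_antitone hA f hs.1 hs.2
  simpa [slope_def_field, div_eq_inv_mul] using this

/-- Laplace transform of `exp (r A)`, for a contraction semigroup. -/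
theorem integral_exp_mul_inner_exp_smul_apply {A : H →L[ℝ] H}
    (hA : ∀ s : ℝ, 0 ≤ s → ∀ f, ‖NormedSpace.exp (s • A) f‖ ≤ ‖f‖) {b : ℝ} (hb : 0 < b) (v g : H) :
    ∫ r in Set.Ioi (0 : ℝ), Real.exp (-b * r) *
      inner ℝ (NormedSpace.exp (r • A) (b • v - A v)) g = inner ℝ v g := by
  -- The integrand has an explicit antiderivative, equal to `-(v, g)` at `0` and vanishing at
  -- infinity by contractivity.
  have hd : ∀ r : ℝ, HasDerivAt
      (fun r : ℝ => -(Real.exp (-b * r) * inner ℝ (NormedSpace.exp (r • A) v) g))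
      (Real.exp (-b * r) * inner ℝ (NormedSpace.exp (r • A) (b • v - A v)) g) r := by
    intro r
    have h1 : HasDerivAt (fun r : ℝ => Real.exp (-b * r)) (Real.exp (-b * r) * (-b)) r := by
      simpa using ((hasDerivAt_id r).const_mul (-b)).exp
    have h2 := (hasDerivAt_exp_smul_apply A v r).inner ℝ (hasDerivAt_const r g)
    convert! (h1.mul h2).neg using 1
    simp [inner_sub_left, inner_smul_left]
    ring
  have hbound : ∀ w : H, ∀ r : ℝ, 0 ≤ r →
      ‖Real.exp (-b * r) * inner ℝ (NormedSpace.exp (r • A) w) g‖ ≤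
        Real.exp (-b * r) * (‖w‖ * ‖g‖) := by
    intro w r hr
    rw [norm_mul, Real.norm_of_nonneg (Real.exp_pos _).le]
    exact mul_le_mul_of_nonneg_left ((norm_inner_le_norm _ _).trans
      (mul_le_mul_of_nonneg_right (hA r hr w) (norm_nonneg _))) (Real.exp_pos _).le
  have hcont : ∀ w : H, Continuous fun r : ℝ =>
      Real.exp (-b * r) * inner ℝ (NormedSpace.exp (r • A) w) g := by
    intro w
    have : Continuous fun r : ℝ => NormedSpace.exp (r • A) w :=
      continuous_iff_continuousAt.2 fun r => (hasDerivAt_exp_smul_apply A w r).continuousAt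
    fun_prop
  have h := integral_Ioi_of_hasDerivAt_of_tendsto (a := 0) (m := 0) (hd 0).continuousAt.continuousWithinAt
    (fun r _ => hd r) ?_ ?_
  · rw [h]; simp
  · refine Integrable.mono' ((exp_neg_integrableOn_Ioi 0 hb).mul_const (‖b • v - A v‖ * ‖g‖))
      (hcont _).aestronglyMeasurable ?_
    filter_upwards [ae_restrict_mem measurableSet_Ioi] with r hr
    exact hbound _ r (le_of_lt hr)
  · rw [← neg_zero]
    refine Tendsto.neg (squeeze_zero_norm' ?_ ?_ (a := fun r => Real.exp (-b * r) * (‖v‖ * ‖g‖)))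
    · filter_upwards [eventually_ge_atTop (0 : ℝ)] with r hr using hbound v r hr
    · have : Tendsto (fun r : ℝ => Real.exp (-b * r)) atTop (𝓝 0) := by
        refine Real.tendsto_exp_atBot.comp ?_
        exact (tendsto_const_mul_atBot_of_neg (by linarith)).2 tendsto_id
      simpa using this.mul_const (‖v‖ * ‖g‖)

end BoundedGenerators

end DirichletParts

/-! ### Closed forms and existence of the resolvent -/

namespace DirichletParts

namespace L2Form

variable {X : Type*} [MeasurableSpace X] {m : Measure X} {E : L2Form m}

/-- Closed forms: densely defined, closed, nonnegative symmetric forms. -/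
structure IsClosedForm (E : L2Form m) : Prop where
  symm : ∀ u v : E.domain, E.bilin u v = E.bilin v u
  nonneg : ∀ u : E.domain, 0 ≤ E.bilin u u
  dense : Dense (E.domain : Set (L2 m))
  closed : ∀ u : ℕ → E.domain,
    (∀ ε : ℝ, 0 < ε → ∃ N : ℕ, ∀ k ≥ N, ∀ l ≥ N, E.energyOne (u k - u l) < ε) →
    ∃ v : E.domain, Tendsto (fun n => E.energyOne (u n - v)) atTop (𝓝 0)

theorem IsDirichletForm.isClosedForm (hE : E.IsDirichletForm) : E.IsClosedForm :=
  ⟨hE.symm, hE.nonneg, hE.dense, hE.closed⟩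

/-- The domain of a form, without the norm inherited from `L²`. -/
def FormDomain (E : L2Form m) : Type _ := E.domain

instance (E : L2Form m) : AddCommGroup E.FormDomain := inferInstanceAs (AddCommGroup E.domain)

instance (E : L2Form m) : Module ℝ E.FormDomain := inferInstanceAs (Module ℝ E.domain)

theorem pencil_add_left (β : ℝ) (u v w : E.domain) :
    E.bilin (u + v) w + β * inner ℝ ((u + v : E.domain) : L2 m) (w : L2 m) =
      (E.bilin u w + β * inner ℝ (u : L2 m) (w : L2 m)) +
        (E.bilin v w + β * inner ℝ (v : L2 m) (w : L2 m)) := by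
  rw [map_add, LinearMap.add_apply, Submodule.coe_add, inner_add_left]
  ring

theorem pencil_smul_left (β r : ℝ) (u v : E.domain) :
    E.bilin (r • u) v + β * inner ℝ ((r • u : E.domain) : L2 m) (v : L2 m) =
      r * (E.bilin u v + β * inner ℝ (u : L2 m) (v : L2 m)) := by
  rw [map_smul, LinearMap.smul_apply, Submodule.coe_smul, real_inner_smul_left, smul_eq_mul]
  ring

/-- The inner product `E(u, v) + β (u, v)` on the domain of a closed form. -/
@[reducible]
noncomputable def IsClosedForm.core (hE : E.IsClosedForm) {β : ℝ} (hβ : 0 < β) :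
    InnerProductSpace.Core ℝ E.FormDomain where
  inner u v := E.bilin u v + β * inner ℝ (Subtype.val u : L2 m) (Subtype.val v)
  conj_inner_symm u v := by
    simp only [conj_trivial]
    rw [real_inner_comm]
    exact congrArg (· + _) (hE.symm v u)
  re_inner_nonneg u := by
    have := hE.nonneg u
    have h2 : 0 ≤ inner ℝ (Subtype.val u : L2 m) (Subtype.val u) := real_inner_self_nonneg
    simp only [RCLike.re_to_real]
    positivity
  add_left u v w := pencil_add_left β u v w
  smul_left u v r := pencil_smul_left β r u v
  definite u hu := by
    have h1 := hE.nonneg u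
    have h2 : 0 ≤ inner ℝ (Subtype.val u : L2 m) (Subtype.val u) := real_inner_self_nonneg
    have h3 : inner ℝ (Subtype.val u : L2 m) (Subtype.val u) = 0 := by
      by_contra h
      have : 0 < β * inner ℝ (Subtype.val u : L2 m) (Subtype.val u) :=
        mul_pos hβ (lt_of_le_of_ne h2 (Ne.symm h))
      linarith
    exact Subtype.ext (inner_self_eq_zero.1 h3)

/-- Closedness makes the domain a Hilbert space under `E(u, v) + β (u, v)`. If `i` is its bounded
embedding into `L²`, the resolvent is `i i*`, because `i* f` represents the functional `v ↦ (f, v)`.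
-/
theorem IsClosedForm.exists_isResolvent (hE : E.IsClosedForm) {β : ℝ} (hβ : 0 < β) :
    ∃ K, E.IsResolvent β K := by
  let _ : NormedAddCommGroup E.FormDomain := (hE.core hβ).toNormedAddCommGroup
  let _ : InnerProductSpace ℝ E.FormDomain := InnerProductSpace.ofCore (hE.core hβ).toCore
  have hinner : ∀ u v : E.FormDomain, inner ℝ u v =
    E.bilin u v + β * inner ℝ (Subtype.val u : L2 m) (Subtype.val v) := fun u v => rfl
  have hnorm : ∀ u : E.FormDomain, ‖u‖ ^ 2 = E.bilin u u + β * ‖(Subtype.val u : L2 m)‖ ^ 2 := by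
    intro u
    rw [← real_inner_self_eq_norm_sq, hinner, real_inner_self_eq_norm_sq]
  have hdist : ∀ u v : E.domain, dist (α := E.FormDomain) u v =
      √(E.bilin (u - v) (u - v) + β * ‖((u - v : E.domain) : L2 m)‖ ^ 2) := by
    intro u v
    exact (dist_eq_norm (E := E.FormDomain) u v).trans
      ((Real.sqrt_sq (norm_nonneg _)).symm.trans (congrArg _ (hnorm _)))
  -- Closedness is stated for the weight `1`; the two bounds show that the weight `β` gives an
  -- equivalent norm.
  have hle : ∀ u : E.domain, E.bilin u u + β * ‖(u : L2 m)‖ ^ 2 ≤ (1 + β) * E.energyOne u := by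
    intro u
    have := hE.nonneg u
    have h2 := sq_nonneg ‖(u : L2 m)‖
    unfold energyOne
    nlinarith
  have hge : ∀ u : E.domain, E.energyOne u ≤
      (1 + β⁻¹) * (E.bilin u u + β * ‖(u : L2 m)‖ ^ 2) := by
    intro u
    have h1 := hE.nonneg u
    have h2 := sq_nonneg ‖(u : L2 m)‖
    unfold energyOne
    have e : (1 + β⁻¹) * (E.bilin u u + β * ‖(u : L2 m)‖ ^ 2) =
      E.bilin u u + ‖(u : L2 m)‖ ^ 2 + β⁻¹ * E.bilin u u + β * ‖(u : L2 m)‖ ^ 2 := by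
      field_simp; ring
    rw [e]
    have : 0 ≤ β⁻¹ * E.bilin u u := by positivity
    have : 0 ≤ β * ‖(u : L2 m)‖ ^ 2 := by positivity
    linarith
  have hc : CompleteSpace E.FormDomain := by
    refine Metric.complete_of_cauchySeq_tendsto fun u hu => ?_
    obtain ⟨v, hv⟩ := hE.closed u fun ε hε => by
      obtain ⟨N, hN⟩ := Metric.cauchySeq_iff.1 hu (√(ε / (1 + β⁻¹))) (by positivity)
      refine ⟨N, fun k hk l hl => (hge _).trans_lt ?_⟩
      have h := (hdist (u k) (u l)).symm.trans_lt (hN k hk l hl)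
      rw [Real.sqrt_lt_sqrt_iff_of_pos (by positivity), lt_div_iff₀ (by positivity)] at h
      rwa [mul_comm]
    refine ⟨v, tendsto_iff_dist_tendsto_zero.2 ?_⟩
    have h0 : Tendsto (fun n => √((1 + β) * E.energyOne (HSub.hSub (α := E.domain) (u n) v)))
        atTop (𝓝 0) := by
      simpa using (hv.const_mul (1 + β)).sqrt
    exact squeeze_zero (fun _ => dist_nonneg)
      (fun n => (hdist (u n) v).trans_le (Real.sqrt_le_sqrt (hle _))) h0
  let i : E.FormDomain →L[ℝ] L2 m := LinearMap.mkContinuous (E.domain.subtype) (√β⁻¹) (by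
    intro u
    rw [← Real.sqrt_sq (norm_nonneg u), ← Real.sqrt_mul (by positivity)]
    refine Real.le_sqrt_of_sq_le ?_
    have := hnorm u
    have h1 := hE.nonneg u
    rw [inv_mul_eq_div, le_div_iff₀ hβ, this, mul_comm]
    exact le_add_of_nonneg_left h1)
  refine ⟨i ∘L ContinuousLinearMap.adjoint i, fun f => ⟨?_, fun v => ?_⟩⟩
  · exact Subtype.property (p := (· ∈ E.domain)) (ContinuousLinearMap.adjoint i f)
  · have h := ContinuousLinearMap.adjoint_inner_left i v f
    exact (hinner _ _).symm.trans h

end L2Form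
end DirichletParts

/-! ### Limits of contractions; resolvent calculus and the Deny–Yosida energies -/

namespace DirichletParts

section Contractions

variable {ι H : Type*} [NormedAddCommGroup H] [InnerProductSpace ℝ H]

theorem tendsto_apply_of_dense {l : Filter ι} {G : ι → H →L[ℝ] H} {G₀ : H →L[ℝ] H}
    (hG : ∀ᶠ i in l, ∀ f, ‖G i f‖ ≤ ‖f‖) (hG₀ : ∀ f, ‖G₀ f‖ ≤ ‖f‖) {D : Set H} (hD : Dense D)
    (h : ∀ f ∈ D, Tendsto (fun i => G i f) l (𝓝 (G₀ f))) (f : H) :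
    Tendsto (fun i => G i f) l (𝓝 (G₀ f)) := by
  rw [Metric.tendsto_nhds]
  intro ε hε
  obtain ⟨g, hgD, hg⟩ := hD.exists_dist_lt f (show 0 < ε / 3 by positivity)
  filter_upwards [hG, Metric.tendsto_nhds.1 (h g hgD) (ε / 3) (by positivity)] with i hi hi'
  rw [dist_eq_norm] at *
  have h1 := hi (f - g)
  have h2 := hG₀ (f - g)
  have e : G i f - G₀ f = G i (f - g) + (G i g - G₀ g) - G₀ (f - g) := by
    simp only [map_sub]; abel
  rw [e]
  linarith [norm_sub_le (G i (f - g) + (G i g - G₀ g)) (G₀ (f - g)),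
    norm_add_le (G i (f - g)) (G i g - G₀ g)]

theorem cauchy_map_apply_of_dense {l : Filter ι} [l.NeBot] {G : ι → H →L[ℝ] H}
    (hG : ∀ᶠ i in l, ∀ f, ‖G i f‖ ≤ ‖f‖) {D : Set H} (hD : Dense D)
    (h : ∀ f ∈ D, Cauchy (map (fun i => G i f) l)) (f : H) : Cauchy (map (fun i => G i f) l) := by
  rw [cauchy_map_iff']
  rw [Metric.uniformity_basis_dist.tendsto_right_iff]
  intro ε hε
  obtain ⟨g, hgD, hg⟩ := hD.exists_dist_lt f (show 0 < ε / 3 by positivity)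
  have hgC := cauchy_map_iff'.1 (h g hgD)
  rw [Metric.uniformity_basis_dist.tendsto_right_iff] at hgC
  filter_upwards [hG.prod_mk hG, hgC (ε / 3) (by positivity)] with p hp hp'
  simp only [Set.mem_ofPred_eq, dist_eq_norm] at *
  have h1 := hp.1 (f - g)
  have h2 := hp.2 (f - g)
  have e : G p.1 f - G p.2 f = G p.1 (f - g) + (G p.1 g - G p.2 g) - G p.2 (f - g) := by
    simp only [map_sub]; abel
  rw [e]
  linarith [norm_sub_le (G p.1 (f - g) + (G p.1 g - G p.2 g)) (G p.2 (f - g)),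
    norm_add_le (G p.1 (f - g)) (G p.1 g - G p.2 g)]

/-- Strong convergence of contractions, applied to a convergent family of vectors. -/
theorem tendsto_apply_of_tendsto {l : Filter ι} {G : ι → H →L[ℝ] H}
    (hG : ∀ᶠ i in l, ∀ f, ‖G i f‖ ≤ ‖f‖) {f : ι → H} {f₀ y : H} (hf : Tendsto f l (𝓝 f₀))
    (h : Tendsto (fun i => G i f₀) l (𝓝 y)) : Tendsto (fun i => G i (f i)) l (𝓝 y) := by
  have h0 : Tendsto (fun i => G i (f i - f₀)) l (𝓝 0) :=
    squeeze_zero_norm' (hG.mono fun i hi => hi _) (tendsto_iff_norm_sub_tendsto_zero.1 hf)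
  simpa using h0.add h

end Contractions

namespace L2Form

variable {X : Type*} [MeasurableSpace X] {m : Measure X} {E : L2Form m}

namespace IsClosedForm

theorem isResolvent_resolvent (hE : E.IsClosedForm) {β : ℝ} (hβ : 0 < β) :
    E.IsResolvent β (E.resolvent β) := by
  have h := hE.exists_isResolvent hβ
  rw [resolvent, dif_pos h]
  exact h.choose_spec

theorem resolvent_mem (hE : E.IsClosedForm) {β : ℝ} (hβ : 0 < β) (f : L2 m) :
    E.resolvent β f ∈ E.domain := (hE.isResolvent_resolvent hβ f).1

theorem bilin_resolvent (hE : E.IsClosedForm) {β : ℝ} (hβ : 0 < β) (f : L2 m) (v : E.domain) :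
    E.bilin ⟨E.resolvent β f, hE.resolvent_mem hβ f⟩ v +
      β * inner ℝ (E.resolvent β f) (v : L2 m) = inner ℝ f (v : L2 m) :=
  (hE.isResolvent_resolvent hβ f).2 v

/-- Subtracting the two resolvent equations and testing with the difference `d` gives `E[d] + β ‖d‖²
= 0`. -/
theorem eq_resolvent (hE : E.IsClosedForm) {β : ℝ} (hβ : 0 < β) {f : L2 m} (u : E.domain)
    (hu : ∀ v : E.domain, E.bilin u v + β * inner ℝ (u : L2 m) (v : L2 m) = inner ℝ f (v : L2 m)) :
    (u : L2 m) = E.resolvent β f := by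
  set k : E.domain := ⟨E.resolvent β f, hE.resolvent_mem hβ f⟩ with hk
  have h1 := hu (u - k)
  have h2 := hE.bilin_resolvent hβ f (u - k)
  have h3 := hE.nonneg (u - k)
  rw [← hk] at h2
  have h4 : E.bilin (u - k) (u - k) = E.bilin u (u - k) - E.bilin k (u - k) := by
    rw [map_sub E.bilin, LinearMap.sub_apply]
  have h5 : inner ℝ ((u : L2 m) - E.resolvent β f) ((u : L2 m) - E.resolvent β f) =
      inner ℝ (u : L2 m) ((u : L2 m) - E.resolvent β f) -
        inner ℝ (E.resolvent β f) ((u : L2 m) - E.resolvent β f) := inner_sub_left _ _ _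
  rw [real_inner_self_eq_norm_sq] at h5
  simp only [Submodule.coe_sub, hk] at h1 h2
  have h6 : β * ‖(u : L2 m) - E.resolvent β f‖ ^ 2 ≤ 0 := by
    rw [h5, mul_sub]; linarith
  have h7 : ‖(u : L2 m) - E.resolvent β f‖ ^ 2 ≤ 0 := by
    by_contra h
    push Not at h
    have := mul_pos hβ h
    linarith
  have h8 : ‖(u : L2 m) - E.resolvent β f‖ = 0 := by
    nlinarith [norm_nonneg ((u : L2 m) - E.resolvent β f)]
  exact sub_eq_zero.1 (norm_eq_zero.1 h8)

/-- `K_α f` solves the `β`-equation with right side `f + (β - α) K_α f`. -/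
theorem resolvent_identity (hE : E.IsClosedForm) {α β : ℝ} (hα : 0 < α) (hβ : 0 < β) (f : L2 m) :
    E.resolvent α f = E.resolvent β f + (β - α) • E.resolvent β (E.resolvent α f) := by
  have h := hE.eq_resolvent hβ (f := f + (β - α) • E.resolvent α f)
    ⟨E.resolvent α f, hE.resolvent_mem hα f⟩ fun v => by
      rw [inner_add_left, real_inner_smul_left, ← hE.bilin_resolvent hα f v]
      ring
  simpa using h

theorem resolvent_comm (hE : E.IsClosedForm) {α β : ℝ} (hα : 0 < α) (hβ : 0 < β) :
    Commute (E.resolvent α) (E.resolvent β) := by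
  rcases eq_or_ne α β with rfl | hne
  · exact Commute.refl _
  ext1 f
  have h1 := hE.resolvent_identity hα hβ f
  have h2 := hE.resolvent_identity hβ hα f
  have h3 : (β - α) • (E.resolvent α (E.resolvent β f) - E.resolvent β (E.resolvent α f)) = 0 := by
    have h4 : (α - β) • E.resolvent α (E.resolvent β f) =
        E.resolvent β f - E.resolvent α f := by rw [eq_sub_iff_add_eq', ← h2]
    have h5 : (β - α) • E.resolvent β (E.resolvent α f) =
        E.resolvent α f - E.resolvent β f := by rw [eq_sub_iff_add_eq', ← h1]
    rw [smul_sub, h5, ← neg_sub α β, neg_smul, h4]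
    abel
  exact sub_eq_zero.1 ((smul_eq_zero.1 h3).resolve_left (sub_ne_zero.2 hne.symm))

theorem isSelfAdjoint_resolvent (hE : E.IsClosedForm) {β : ℝ} (hβ : 0 < β) :
    IsSelfAdjoint (E.resolvent β) := by
  rw [ContinuousLinearMap.isSelfAdjoint_iff_isSymmetric]
  intro f g
  have h1 := hE.bilin_resolvent hβ f ⟨E.resolvent β g, hE.resolvent_mem hβ g⟩
  have h2 := hE.bilin_resolvent hβ g ⟨E.resolvent β f, hE.resolvent_mem hβ f⟩
  rw [hE.symm, real_inner_comm] at h2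
  simp only [ContinuousLinearMap.coe_coe]
  rw [real_inner_comm, ← h2, ← h1]

theorem norm_smul_resolvent_apply_le (hE : E.IsClosedForm) {β : ℝ} (hβ : 0 < β) (f : L2 m) :
    ‖(β • E.resolvent β) f‖ ≤ ‖f‖ := by
  have h1 := hE.bilin_resolvent hβ f ⟨E.resolvent β f, hE.resolvent_mem hβ f⟩
  have h2 := hE.nonneg ⟨E.resolvent β f, hE.resolvent_mem hβ f⟩
  simp only [real_inner_self_eq_norm_sq] at h1
  have h3 := real_inner_le_norm f (E.resolvent β f)
  rw [smul_apply, norm_smul, Real.norm_of_nonneg hβ.le]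
  rcases (norm_nonneg (E.resolvent β f)).eq_or_lt with h | h
  · rw [← h, mul_zero]; exact norm_nonneg _
  · refine le_of_mul_le_mul_right ?_ h
    nlinarith

theorem bilin_sub_self (hE : E.IsClosedForm) (u v : E.domain) :
    E.bilin (u - v) (u - v) = E.bilin u u - 2 * E.bilin u v + E.bilin v v := by
  rw [map_sub E.bilin, LinearMap.sub_apply, map_sub, map_sub, hE.symm v u]
  ring

/-- The Deny–Yosida approximation as a minimum: completing the square. -/
theorem yosida_add_eq (hE : E.IsClosedForm) {β : ℝ} (hβ : 0 < β) (u : L2 m) {p v : E.domain}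
    (hp : (p : L2 m) = β • E.resolvent β u) :
    β * inner ℝ (u - β • E.resolvent β u) u + E.bilin (v - p) (v - p) +
      β * ‖(v : L2 m) - p‖ ^ 2 = E.bilin v v + β * ‖u - v‖ ^ 2 := by
  have hp' : p = β • (⟨E.resolvent β u, hE.resolvent_mem hβ u⟩ : E.domain) := Subtype.ext hp
  -- The Euler equation of the minimisation of `E[v] + β ‖u - v‖²`.
  have key : ∀ w : E.domain, E.bilin p w + β * inner ℝ (p : L2 m) (w : L2 m) =
      β * inner ℝ u (w : L2 m) := by
    intro w
    rw [← hE.bilin_resolvent hβ u w, hp', map_smul, LinearMap.smul_apply, Submodule.coe_smul,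
      real_inner_smul_left, smul_eq_mul]
    ring
  have k1 := key p
  have k2 := key v
  rw [← hp, hE.bilin_sub_self, hE.symm v p, inner_sub_left, norm_sub_sq_real, norm_sub_sq_real, real_inner_self_eq_norm_sq]
  rw [real_inner_self_eq_norm_sq] at k1
  rw [real_inner_comm (p : L2 m) (v : L2 m), real_inner_comm u (p : L2 m)]
  linarith

theorem inner_sub_smul_resolvent_nonneg (hE : E.IsClosedForm) {β : ℝ} (hβ : 0 < β) (u : L2 m) :
    0 ≤ inner ℝ (u - β • E.resolvent β u) u := by
  have h1 := hE.norm_smul_resolvent_apply_le hβ u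
  rw [smul_apply] at h1
  rw [inner_sub_left, real_inner_self_eq_norm_sq]
  have h2 := real_inner_le_norm (β • E.resolvent β u) u
  nlinarith [norm_nonneg u]

/-- The minimiser `β K_β u`, as an element of the domain. -/
theorem exists_coe_eq_smul_resolvent (hE : E.IsClosedForm) {β : ℝ} (hβ : 0 < β) (u : L2 m) :
    ∃ p : E.domain, (p : L2 m) = β • E.resolvent β u :=
  ⟨⟨_, E.domain.smul_mem β (hE.resolvent_mem hβ u)⟩, rfl⟩

theorem yosida_le (hE : E.IsClosedForm) {β : ℝ} (hβ : 0 < β) (u : L2 m) (v : E.domain) :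
    β * inner ℝ (u - β • E.resolvent β u) u ≤ E.bilin v v + β * ‖u - v‖ ^ 2 := by
  obtain ⟨p, hp⟩ := hE.exists_coe_eq_smul_resolvent hβ u
  have := hE.yosida_add_eq hβ u (v := v) hp
  have := hE.nonneg (v - p)
  have : 0 ≤ β * ‖(v : L2 m) - p‖ ^ 2 := by positivity
  linarith

theorem yosida_eq (hE : E.IsClosedForm) {β : ℝ} (hβ : 0 < β) (u : L2 m) {p : E.domain}
    (hp : (p : L2 m) = β • E.resolvent β u) :
    β * inner ℝ (u - β • E.resolvent β u) u = E.bilin p p + β * ‖u - p‖ ^ 2 := by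
  have := hE.yosida_add_eq hβ u (v := p) hp
  simpa using this

/-- The functional being minimised increases with `β`; the minimiser for `β` serves as competitor
for `α`. -/
theorem yosida_mono (hE : E.IsClosedForm) {α β : ℝ} (hα : 0 < α) (h : α ≤ β) (u : L2 m) :
    α * inner ℝ (u - α • E.resolvent α u) u ≤ β * inner ℝ (u - β • E.resolvent β u) u := by
  obtain ⟨p, hp⟩ := hE.exists_coe_eq_smul_resolvent (hα.trans_le h) u
  rw [hE.yosida_eq (hα.trans_le h) u hp]
  refine (hE.yosida_le hα u p).trans ?_
  gcongr

theorem yosida_le_bilin (hE : E.IsClosedForm) {β : ℝ} (hβ : 0 < β) (u : E.domain) :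
    β * inner ℝ ((u : L2 m) - β • E.resolvent β (u : L2 m)) (u : L2 m) ≤ E.bilin u u := by
  simpa using hE.yosida_le hβ u u

/-- For `u` in the domain, completing the square at `v = u` gives `β ‖u - β K_β u‖² ≤ E[u]`. Density
and contractivity do the rest. -/
theorem tendsto_smul_resolvent (hE : E.IsClosedForm) (f : L2 m) :
    Tendsto (fun β : ℝ => (β • E.resolvent β) f) atTop (𝓝 f) := by
  refine tendsto_apply_of_dense (G₀ := 1) ?_ (fun _ => le_rfl) hE.dense ?_ f
  · filter_upwards [eventually_gt_atTop (0 : ℝ)] with β hβ f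
    exact hE.norm_smul_resolvent_apply_le hβ f
  · intro u hu
    rw [tendsto_iff_norm_sub_tendsto_zero]
    have h0 : Tendsto (fun β : ℝ => √(E.bilin ⟨u, hu⟩ ⟨u, hu⟩ / β)) atTop (𝓝 0) := by
      simpa using (tendsto_const_nhds.div_atTop tendsto_id).sqrt
    refine squeeze_zero' (Eventually.of_forall fun _ => norm_nonneg _) ?_ h0
    filter_upwards [eventually_gt_atTop (0 : ℝ)] with β hβ
    refine Real.le_sqrt_of_sq_le ?_
    obtain ⟨p, hp⟩ := hE.exists_coe_eq_smul_resolvent hβ u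
    have h1 := hE.yosida_add_eq hβ u (v := ⟨u, hu⟩) hp
    have h2 := hE.inner_sub_smul_resolvent_nonneg hβ u
    have h3 := hE.nonneg (⟨u, hu⟩ - p)
    have h4 : 0 ≤ β * inner ℝ (u - β • E.resolvent β u) u := by positivity
    rw [le_div_iff₀ hβ, norm_sub_rev]
    simp only [sub_self, norm_zero] at h1
    change ‖u - β • E.resolvent β u‖ ^ 2 * β ≤ _
    rw [← hp]
    linarith

/-- A vector whose Deny–Yosida energies are bounded lies in the domain, with the same bound. -/
theorem mem_domain_of_yosida_le (hE : E.IsClosedForm) (u : L2 m) (c : ℝ)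
    (h : ∀ β : ℝ, 0 < β → β * inner ℝ (u - β • E.resolvent β u) u ≤ c) :
    ∃ hu : u ∈ E.domain, E.bilin ⟨u, hu⟩ ⟨u, hu⟩ ≤ c := by
  have hpos : ∀ n : ℕ, (0 : ℝ) < n + 1 := fun n => by positivity
  choose p hp using fun n : ℕ => hE.exists_coe_eq_smul_resolvent (hpos n) u
  set a : ℕ → ℝ := fun n =>
    ((n : ℝ) + 1) * inner ℝ (u - ((n : ℝ) + 1) • E.resolvent ((n : ℝ) + 1) u) u with ha
  have hamono : Monotone a := fun k l hkl => hE.yosida_mono (hpos k) (by gcongr) u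
  have hac : ∀ n, a n ≤ c := fun n => h _ (hpos n)
  have hconv := tendsto_atTop_ciSup hamono ⟨c, by rintro _ ⟨n, rfl⟩; exact hac n⟩
  have haC := Metric.cauchySeq_iff.1 hconv.cauchySeq
  -- Completing the square at level `k` with competitor `p l` bounds the `E₁`-distance by the
  -- increment of a bounded monotone sequence. The levels `n + 1 ≥ 1` absorb the weight of the `L²`
  -- term.
  have hdiff : ∀ k l, k ≤ l → E.energyOne (p l - p k) ≤ a l - a k := by
    intro k l hkl
    have h1 := hE.yosida_add_eq (hpos k) u (v := p l) (hp k)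
    have h2 := hE.yosida_eq (hpos l) u (hp l)
    have h3 : ((k : ℝ) + 1) * ‖u - p l‖ ^ 2 ≤ ((l : ℝ) + 1) * ‖u - p l‖ ^ 2 := by gcongr
    have h4 : ‖(p l : L2 m) - p k‖ ^ 2 ≤ ((k : ℝ) + 1) * ‖(p l : L2 m) - p k‖ ^ 2 :=
      le_mul_of_one_le_left (by positivity) (by linarith [Nat.cast_nonneg (α := ℝ) k])
    simp only [energyOne, Submodule.coe_sub, ha]
    linarith
  have hrev : ∀ k l, E.energyOne (p k - p l) = E.energyOne (p l - p k) := by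
    intro k l
    unfold energyOne
    rw [← neg_sub (p l) (p k), map_neg E.bilin, LinearMap.neg_apply, map_neg, neg_neg, Submodule.coe_neg,
      norm_neg]
  obtain ⟨v, hv⟩ := hE.closed p fun ε hε => by
    obtain ⟨N, hN⟩ := haC ε hε
    refine ⟨N, fun k hk l hl => ?_⟩
    have hd := hN k hk l hl
    rw [Real.dist_eq] at hd
    rcases le_total k l with hkl | hkl
    · rw [hrev]
      exact (hdiff k l hkl).trans_lt (by linarith [neg_abs_le (a k - a l)])
    · exact (hdiff l k hkl).trans_lt ((le_abs_self _).trans_lt hd)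
  have hnorm : Tendsto (fun n => ‖(p n : L2 m) - v‖) atTop (𝓝 0) := by
    have h0 : Tendsto (fun n => √(E.energyOne (p n - v))) atTop (𝓝 0) := by simpa using hv.sqrt
    refine squeeze_zero (fun _ => norm_nonneg _) (fun n => Real.le_sqrt_of_sq_le ?_) h0
    have := hE.nonneg (p n - v)
    simp only [energyOne, Submodule.coe_sub]
    linarith
  have hpv : Tendsto (fun n => (p n : L2 m)) atTop (𝓝 v) := tendsto_iff_norm_sub_tendsto_zero.2 hnorm
  have hpu : Tendsto (fun n => (p n : L2 m)) atTop (𝓝 u) := by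
    have := (hE.tendsto_smul_resolvent u).comp
      (tendsto_atTop_add_const_right atTop (1 : ℝ) tendsto_natCast_atTop_atTop)
    refine this.congr fun n => ?_
    simp [hp]
  have huv : u = v := tendsto_nhds_unique hpu hpv
  subst huv
  refine ⟨v.2, ?_⟩
  have hE0 : Tendsto (fun n => E.bilin (p n - v) (p n - v)) atTop (𝓝 0) := by
    refine squeeze_zero (fun n => hE.nonneg _) (fun n => ?_) hv
    exact le_add_of_nonneg_right (sq_nonneg _)
  -- The triangle inequality for the seminorm `√E`, with Cauchy–Schwarz obtained from the
  -- discriminant of `s ↦ E[p n + s d]`.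
  have hcs : ∀ n, E.bilin v v ≤ (√c + √(E.bilin (p n - v) (p n - v))) ^ 2 := by
    intro n
    have hpc : E.bilin (p n) (p n) ≤ c := by
      have h2 := hE.yosida_eq (hpos n) (v : L2 m) (hp n)
      have h3 : 0 ≤ ((n : ℝ) + 1) * ‖(v : L2 m) - p n‖ ^ 2 := by positivity
      have := hac n
      simp only [ha] at this
      linarith
    have hc0 : 0 ≤ c := (hE.nonneg _).trans hpc
    set d := p n - v with hd
    have hvd : v = p n - d := by rw [hd]; abel
    set x := E.bilin (p n) (p n) with hx
    set y := E.bilin d d with hy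
    have hexp : ∀ s : ℝ, 0 ≤ x + 2 * s * E.bilin (p n) d + s ^ 2 * y := by
      intro s
      have := hE.nonneg (p n + s • d)
      simp only [map_add, map_smul, LinearMap.add_apply, LinearMap.smul_apply, smul_eq_mul] at this
      rw [hE.symm d (p n)] at this
      linarith
    have hdisc : E.bilin (p n) d ^ 2 ≤ x * y := by
      have := discrim_le_zero (a := y) (b := 2 * E.bilin (p n) d) (c := x) fun s => by
        have := hexp s; linarith
      unfold discrim at this
      linarith
    have hb : - E.bilin (p n) d ≤ √c * √y := by
      rw [← Real.sqrt_mul hc0]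
      refine Real.le_sqrt_of_sq_le ?_
      rw [neg_sq]
      exact hdisc.trans (mul_le_mul_of_nonneg_right hpc (hE.nonneg _))
    have hv' : E.bilin v v = x - 2 * E.bilin (p n) d + y := by
      have := hE.bilin_sub_self (p n) d
      rwa [← hvd] at this
    rw [hv', add_sq, Real.sq_sqrt hc0, Real.sq_sqrt (hE.nonneg _)]
    linarith
  have hc0 : 0 ≤ c := by
    have h2 := hE.inner_sub_smul_resolvent_nonneg one_pos (v : L2 m)
    have := h 1 one_pos
    linarith
  have hlim : Tendsto (fun n => (√c + √(E.bilin (p n - v) (p n - v))) ^ 2) atTop (𝓝 c) := by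
    have := (tendsto_const_nhds (x := √c)).add hE0.sqrt |>.pow 2
    simpa [Real.sq_sqrt hc0] using this
  exact ge_of_tendsto' hlim hcs

end IsClosedForm

end L2Form
end DirichletParts

/-! ### The Hille–Yosida construction of the semigroup and its Laplace transform -/

namespace DirichletParts

namespace L2Form

variable {X : Type*} [MeasurableSpace X] {m : Measure X} {E : L2Form m}

/-- The Yosida approximation `β (β K_β - 1)` of the generator. -/
noncomputable def yosidaGen (E : L2Form m) (β : ℝ) : L2 m →L[ℝ] L2 m :=
  β • (β • E.resolvent β - 1)

theorem smul_yosidaGen (E : L2Form m) (t β : ℝ) :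
    t • E.yosidaGen β = (t * β) • (β • E.resolvent β - 1) := smul_smul _ _ _

theorem isSemigroupAt_iff {t : ℝ} {T : L2 m →L[ℝ] L2 m} : E.IsSemigroupAt t T ↔
    ∀ f, Tendsto (fun β : ℝ => NormedSpace.exp (t • E.yosidaGen β) f) atTop (𝓝 (T f)) := by
  simp only [smul_yosidaGen]; rfl

theorem semigroup_eq {t : ℝ} {T : L2 m →L[ℝ] L2 m} (h : E.IsSemigroupAt t T) :
    E.semigroup t = T := by
  have h' : ∃ T, E.IsSemigroupAt t T := ⟨T, h⟩
  rw [semigroup, dif_pos h']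
  ext1 f
  exact tendsto_nhds_unique (h'.choose_spec f) (h f)

namespace IsClosedForm

theorem isSelfAdjoint_yosidaGen (hE : E.IsClosedForm) {β : ℝ} (hβ : 0 < β) :
    IsSelfAdjoint (E.yosidaGen β) :=
  (IsSelfAdjoint.all β).smul
    (((IsSelfAdjoint.all β).smul (hE.isSelfAdjoint_resolvent hβ)).sub (IsSelfAdjoint.one _))

theorem commute_resolvent_yosidaGen (hE : E.IsClosedForm) {α β : ℝ} (hα : 0 < α) (hβ : 0 < β) :
    Commute (E.resolvent α) (E.yosidaGen β) :=
  (((hE.resolvent_comm hα hβ).smul_right β).sub_right (Commute.one_right _)).smul_right β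

theorem commute_yosidaGen (hE : E.IsClosedForm) {α β : ℝ} (hα : 0 < α) (hβ : 0 < β) :
    Commute (E.yosidaGen α) (E.yosidaGen β) :=
  (((hE.commute_resolvent_yosidaGen hα hβ).smul_left α).sub_left (Commute.one_left _)).smul_left α

theorem norm_exp_smul_yosidaGen_apply_le (hE : E.IsClosedForm) {β : ℝ} (hβ : 0 < β) (t : ℝ)
    (ht : 0 ≤ t) (f : L2 m) : ‖NormedSpace.exp (t • E.yosidaGen β) f‖ ≤ ‖f‖ := by
  rw [smul_yosidaGen]
  exact norm_exp_smul_sub_one_apply_le (hE.norm_smul_resolvent_apply_le hβ) (by positivity) f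

/-- On the range of `K_α` the Yosida generators are `β K_β` applied to a vector independent of `β`,
so they converge there as `β → ∞`. -/
theorem yosidaGen_resolvent (hE : E.IsClosedForm) {α β : ℝ} (hα : 0 < α) (hβ : 0 < β) (f : L2 m) :
    E.yosidaGen β (E.resolvent α f) = (β • E.resolvent β) (α • E.resolvent α f - f) := by
  have h := hE.resolvent_identity hα hβ f
  simp only [yosidaGen, smul_apply, sub_apply, one_apply_eq_self, map_sub,
    map_smul]
  generalize E.resolvent β (E.resolvent α f) = a at h ⊢
  rw [h]
  module

theorem tendsto_yosidaGen_resolvent (hE : E.IsClosedForm) {α : ℝ} (hα : 0 < α) (f : L2 m) :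
    Tendsto (fun β => E.yosidaGen β (E.resolvent α f)) atTop (𝓝 (α • E.resolvent α f - f)) := by
  refine (hE.tendsto_smul_resolvent _).congr' ?_
  filter_upwards [eventually_gt_atTop (0 : ℝ)] with β hβ
  exact (hE.yosidaGen_resolvent hα hβ f).symm

theorem dense_range_resolvent (hE : E.IsClosedForm) :
    Dense {u : L2 m | ∃ α : ℝ, 0 < α ∧ ∃ f, u = E.resolvent α f} := by
  intro f
  refine mem_closure_of_tendsto (hE.tendsto_smul_resolvent f) ?_
  filter_upwards [eventually_gt_atTop (0 : ℝ)] with β hβ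
  exact ⟨β, hβ, β • f, by simp⟩

theorem eventually_exp_contraction (hE : E.IsClosedForm) {t : ℝ} (ht : 0 ≤ t) :
    ∀ᶠ β : ℝ in atTop, ∀ f : L2 m, ‖NormedSpace.exp (t • E.yosidaGen β) f‖ ≤ ‖f‖ := by
  filter_upwards [eventually_gt_atTop (0 : ℝ)] with β hβ f
  exact hE.norm_exp_smul_yosidaGen_apply_le hβ t ht f

/-- The Hille–Yosida theorem. -/
theorem exists_isSemigroupAt (hE : E.IsClosedForm) {t : ℝ} (ht : 0 ≤ t) :
    ∃ T, E.IsSemigroupAt t T := by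
  have hC : ∀ f : L2 m, Cauchy (map (fun β : ℝ => NormedSpace.exp (t • E.yosidaGen β) f) atTop) := by
    refine cauchy_map_apply_of_dense (hE.eventually_exp_contraction ht)
      hE.dense_range_resolvent ?_
    rintro _ ⟨α, hα, f, rfl⟩
    have hc := cauchy_map_iff'.1 (hE.tendsto_yosidaGen_resolvent hα f).cauchy_map
    rw [cauchy_map_iff']
    rw [Metric.uniformity_basis_dist.tendsto_right_iff] at *
    intro ε hε
    -- Dividing by `t + 1` rather than `t` covers `t = 0`.
    filter_upwards [hc (ε / (t + 1)) (by positivity), (eventually_gt_atTop (0 : ℝ)).prod_mk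
      (eventually_gt_atTop (0 : ℝ))] with p hp hp0
    simp only [Set.mem_ofPred_eq, dist_eq_norm] at *
    rw [lt_div_iff₀ (by positivity)] at hp
    refine (norm_exp_sub_exp_apply_le (hE.commute_yosidaGen hp0.1 hp0.2)
      (hE.norm_exp_smul_yosidaGen_apply_le hp0.1)
      (hE.norm_exp_smul_yosidaGen_apply_le hp0.2) ht _).trans_lt ?_
    refine lt_of_le_of_lt ?_ hp
    rw [mul_comm]
    gcongr
    linarith
  choose y hy using fun f => CompleteSpace.complete (hC f)
  exact ⟨continuousLinearMapOfTendsto (fun β : ℝ => NormedSpace.exp (t • E.yosidaGen β))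
    (tendsto_pi_nhds.2 hy), isSemigroupAt_iff.2 hy⟩

theorem tendsto_semigroup (hE : E.IsClosedForm) {t : ℝ} (ht : 0 ≤ t) (f : L2 m) :
    Tendsto (fun β : ℝ => NormedSpace.exp (t • E.yosidaGen β) f) atTop (𝓝 (E.semigroup t f)) := by
  obtain ⟨T, hT⟩ := hE.exists_isSemigroupAt ht
  rw [semigroup_eq hT]
  exact isSemigroupAt_iff.1 hT f

theorem norm_semigroup_apply_le (hE : E.IsClosedForm) {t : ℝ} (ht : 0 ≤ t) (f : L2 m) :
    ‖E.semigroup t f‖ ≤ ‖f‖ :=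
  le_of_tendsto (hE.tendsto_semigroup ht f).norm
    ((hE.eventually_exp_contraction ht).mono fun _ h => h f)

theorem semigroup_zero (hE : E.IsClosedForm) : E.semigroup 0 = 1 := by
  ext1 f
  refine tendsto_nhds_unique (hE.tendsto_semigroup le_rfl f) ?_
  simp

theorem semigroup_add (hE : E.IsClosedForm) {s t : ℝ} (hs : 0 ≤ s) (ht : 0 ≤ t) :
    E.semigroup (s + t) = E.semigroup s * E.semigroup t := by
  ext1 f
  refine tendsto_nhds_unique (hE.tendsto_semigroup (add_nonneg hs ht) f) ?_
  simp only [exp_add_smul, mul_apply_eq_comp]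
  exact tendsto_apply_of_tendsto (hE.eventually_exp_contraction hs) (hE.tendsto_semigroup ht f)
    (hE.tendsto_semigroup hs _)

theorem semigroup_nat_mul (hE : E.IsClosedForm) {t : ℝ} (ht : 0 ≤ t) (n : ℕ) :
    E.semigroup (n * t) = E.semigroup t ^ n := by
  induction n with
  | zero => simp [hE.semigroup_zero]
  | succ n ih =>
    rw [Nat.cast_succ, add_mul, one_mul, hE.semigroup_add (by positivity) ht, ih, pow_succ]

theorem isSelfAdjoint_semigroup (hE : E.IsClosedForm) {t : ℝ} (ht : 0 ≤ t) :
    IsSelfAdjoint (E.semigroup t) := by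
  rw [ContinuousLinearMap.isSelfAdjoint_iff_isSymmetric]
  intro f g
  refine tendsto_nhds_unique ((hE.tendsto_semigroup ht f).inner (tendsto_const_nhds (x := g))) ?_
  refine ((tendsto_const_nhds (x := f)).inner (hE.tendsto_semigroup ht g)).congr' ?_
  filter_upwards [eventually_gt_atTop (0 : ℝ)] with β hβ
  have h : IsSelfAdjoint (NormedSpace.exp (t • E.yosidaGen β)) :=
    ((IsSelfAdjoint.all t).smul (hE.isSelfAdjoint_yosidaGen hβ)).exp
  exact ((ContinuousLinearMap.isSelfAdjoint_iff_isSymmetric.1 h) f g).symm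

theorem commute_resolvent_semigroup (hE : E.IsClosedForm) {α t : ℝ} (hα : 0 < α) (ht : 0 ≤ t) :
    Commute (E.resolvent α) (E.semigroup t) := by
  ext1 f
  refine tendsto_nhds_unique (((E.resolvent α).continuous.tendsto _).comp
    (hE.tendsto_semigroup ht f)) ?_
  refine (hE.tendsto_semigroup ht (E.resolvent α f)).congr' ?_
  let _ : NormedAlgebra ℚ (L2 m →L[ℝ] L2 m) := NormedAlgebra.restrictScalars ℚ ℝ _
  filter_upwards [eventually_gt_atTop (0 : ℝ)] with β hβ
  exact congrArg (fun L : L2 m →L[ℝ] L2 m => L f)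
    ((hE.commute_resolvent_yosidaGen hα hβ).smul_right t).exp_right.eq.symm

theorem tendsto_inner_sub_exp (hE : E.IsClosedForm) {t : ℝ} (ht : 0 ≤ t) (u : L2 m) :
    Tendsto (fun β : ℝ => t⁻¹ * inner ℝ (u - NormedSpace.exp (t • E.yosidaGen β) u) u) atTop
      (𝓝 (t⁻¹ * inner ℝ (u - E.semigroup t u) u)) :=
  (((hE.tendsto_semigroup ht u).const_sub u).inner tendsto_const_nhds).const_mul _

theorem timeEnergy_antitone (hE : E.IsClosedForm) {s t : ℝ} (hs : 0 < s) (hst : s ≤ t)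
    (u : L2 m) : t⁻¹ * inner ℝ (u - E.semigroup t u) u ≤ s⁻¹ * inner ℝ (u - E.semigroup s u) u := by
  refine le_of_tendsto_of_tendsto (hE.tendsto_inner_sub_exp (hs.le.trans hst) u)
    (hE.tendsto_inner_sub_exp hs.le u) ?_
  filter_upwards [eventually_gt_atTop (0 : ℝ)] with β hβ
  exact inner_sub_exp_smul_apply_antitone (hE.isSelfAdjoint_yosidaGen hβ) u hs hst

/-- For the bounded generators the time energy lies below the Deny–Yosida energy, which lies below
`E[u]`; then `β → ∞`. -/
theorem timeEnergy_le_bilin (hE : E.IsClosedForm) {t : ℝ} (ht : 0 < t) (u : E.domain) :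
    t⁻¹ * inner ℝ ((u : L2 m) - E.semigroup t u) (u : L2 m) ≤ E.bilin u u := by
  refine le_of_tendsto (hE.tendsto_inner_sub_exp ht.le u) ?_
  filter_upwards [eventually_gt_atTop (0 : ℝ)] with β hβ
  refine (inner_sub_exp_smul_apply_le (hE.isSelfAdjoint_yosidaGen hβ) (u : L2 m) ht).trans ?_
  refine le_trans (le_of_eq ?_) (hE.yosida_le_bilin hβ u)
  rw [← inner_neg_left, ← real_inner_smul_left]
  congr 1
  simp [yosidaGen, ← smul_neg]

/-- A pointwise limit of functions continuous in `r`; strong continuity of the semigroup is not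
needed. -/
theorem aestronglyMeasurable_inner_semigroup (hE : E.IsClosedForm) (f g : L2 m) :
    AEStronglyMeasurable (fun r : ℝ => inner ℝ (E.semigroup r f) g)
      (volume.restrict (Set.Ioi 0)) := by
  refine aestronglyMeasurable_of_tendsto_ae (u := (atTop : Filter ℕ))
    (f := fun n r => inner ℝ (NormedSpace.exp (r • E.yosidaGen n) f) g) (fun n => ?_) ?_
  · have : Continuous fun r : ℝ => NormedSpace.exp (r • E.yosidaGen n) f :=
      continuous_iff_continuousAt.2 fun r => (hasDerivAt_exp_smul_apply _ f r).continuousAt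
    exact (this.inner continuous_const).aestronglyMeasurable
  · filter_upwards [ae_restrict_mem measurableSet_Ioi] with r hr
    exact ((hE.tendsto_semigroup (le_of_lt hr) f).comp tendsto_natCast_atTop_atTop).inner
      tendsto_const_nhds

theorem abs_inner_semigroup_le (hE : E.IsClosedForm) {t : ℝ} (ht : 0 ≤ t) (f g : L2 m) :
    |inner ℝ (E.semigroup t f) g| ≤ ‖f‖ * ‖g‖ :=
  (abs_real_inner_le_norm _ _).trans
    (mul_le_mul_of_nonneg_right (hE.norm_semigroup_apply_le ht f) (norm_nonneg _))

theorem integrableOn_exp_mul_inner_semigroup (hE : E.IsClosedForm) {β : ℝ} (hβ : 0 < β)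
    (f g : L2 m) : IntegrableOn (fun r : ℝ => Real.exp (-β * r) * inner ℝ (E.semigroup r f) g)
      (Set.Ioi 0) := by
  refine Integrable.mono' ((exp_neg_integrableOn_Ioi 0 hβ).mul_const (‖f‖ * ‖g‖))
    (AEStronglyMeasurable.mul (by fun_prop) (hE.aestronglyMeasurable_inner_semigroup f g)) ?_
  filter_upwards [ae_restrict_mem measurableSet_Ioi] with r hr
  rw [norm_mul, Real.norm_of_nonneg (Real.exp_pos _).le]
  exact mul_le_mul_of_nonneg_left (hE.abs_inner_semigroup_le (le_of_lt hr) f g) (Real.exp_pos _).le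

/-- The resolvent is the Laplace transform of the semigroup. -/
theorem integral_exp_mul_inner_semigroup (hE : E.IsClosedForm) {β : ℝ} (hβ : 0 < β) (f g : L2 m) :
    ∫ r in Set.Ioi (0 : ℝ), Real.exp (-β * r) * inner ℝ (E.semigroup r f) g =
      inner ℝ (E.resolvent β f) g := by
  set v := E.resolvent β f with hv
  -- This choice makes the Laplace formula for the `n`-th bounded generator return exactly `(v, g)`
  -- for every `n > 0`, while `w n → f`.
  let w : ℕ → L2 m := fun n => β • v - E.yosidaGen n v
  have hw : Tendsto w atTop (𝓝 f) := by
    have := ((hE.tendsto_yosidaGen_resolvent hβ f).comp tendsto_natCast_atTop_atTop).const_sub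
      (β • v)
    simpa [w, Function.comp_def, hv] using this
  obtain ⟨C, hC⟩ := hw.norm.bddAbove_range
  have hpos : ∀ᶠ n : ℕ in atTop, (0 : ℝ) < n := by
    filter_upwards [eventually_gt_atTop 0] with n hn using by exact_mod_cast hn
  refine tendsto_nhds_unique (f := fun n : ℕ => ∫ r in Set.Ioi (0 : ℝ), Real.exp (-β * r) *
    inner ℝ (NormedSpace.exp (r • E.yosidaGen n) (w n)) g) (l := atTop) ?_ ?_
  · refine tendsto_integral_filter_of_dominated_convergence
      (fun r => Real.exp (-β * r) * (C * ‖g‖)) ?_ ?_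
      ((exp_neg_integrableOn_Ioi 0 hβ).mul_const _) ?_
    · refine Eventually.of_forall fun n => ?_
      have : Continuous fun r : ℝ => NormedSpace.exp (r • E.yosidaGen n) (w n) :=
        continuous_iff_continuousAt.2 fun r => (hasDerivAt_exp_smul_apply _ _ r).continuousAt
      exact Continuous.aestronglyMeasurable (by fun_prop)
    · filter_upwards [hpos] with n hn
      filter_upwards [ae_restrict_mem measurableSet_Ioi] with r hr
      rw [norm_mul, Real.norm_of_nonneg (Real.exp_pos _).le]
      refine mul_le_mul_of_nonneg_left ((norm_inner_le_norm _ _).trans ?_) (Real.exp_pos _).le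
      exact mul_le_mul_of_nonneg_right ((hE.norm_exp_smul_yosidaGen_apply_le hn r (le_of_lt hr) _).trans
        (hC ⟨n, rfl⟩)) (norm_nonneg _)
    · filter_upwards [ae_restrict_mem measurableSet_Ioi] with r hr
      refine Tendsto.const_mul _ (Tendsto.inner ?_ tendsto_const_nhds)
      exact tendsto_apply_of_tendsto
        (tendsto_natCast_atTop_atTop.eventually (hE.eventually_exp_contraction (le_of_lt hr))) hw
        ((hE.tendsto_semigroup (le_of_lt hr) f).comp tendsto_natCast_atTop_atTop)
  · refine tendsto_const_nhds.congr' ?_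
    filter_upwards [hpos] with n hn
    exact (integral_exp_mul_inner_exp_smul_apply (hE.norm_exp_smul_yosidaGen_apply_le hn) hβ v g).symm

theorem integral_exp_neg_mul {β : ℝ} (hβ : 0 < β) :
    ∫ r in Set.Ioi (0 : ℝ), Real.exp (-β * r) = β⁻¹ := by
  have := integral_exp_mul_Ioi (a := -β) (by linarith) 0
  simpa using this

/-- A vector whose time dependent energies are bounded lies in the domain, with the same bound. -/
theorem mem_domain_of_timeEnergy_le (hE : E.IsClosedForm) (u : L2 m) (c : ℝ)
    (h : ∀ t : ℝ, 0 < t → t⁻¹ * inner ℝ (u - E.semigroup t u) u ≤ c) :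
    ∃ hu : u ∈ E.domain, E.bilin ⟨u, hu⟩ ⟨u, hu⟩ ≤ c := by
  refine hE.mem_domain_of_yosida_le u c fun β hβ => ?_
  have hi := exp_neg_integrableOn_Ioi 0 hβ
  have hr : IntegrableOn (fun r : ℝ => r * Real.exp (-β * r)) (Set.Ioi 0) := by
    have := integrableOn_rpow_mul_exp_neg_mul_rpow (p := 1) (s := 1) (b := β) (by norm_num)
      one_pos hβ
    simpa using this
  have hr' : ∫ r in Set.Ioi (0 : ℝ), r * Real.exp (-β * r) = (β ^ 2)⁻¹ := by
    have := Real.integral_rpow_mul_exp_neg_mul_Ioi (a := 2) (r := β) (by norm_num) hβ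
    norm_num at this
    simpa using this
  -- As `β e^{-βr}` is a probability density, the resolvent defect is an average of the semigroup
  -- defects. These are at most `c r`, and `∫ r e^{-βr} dr = β⁻²` yields exactly the bound `c`.
  have e : inner ℝ (u - β • E.resolvent β u) u =
      β * ∫ r in Set.Ioi (0 : ℝ), Real.exp (-β * r) * inner ℝ (u - E.semigroup r u) u := by
    simp only [inner_sub_left, mul_sub]
    rw [integral_sub (hi.mul_const _) (hE.integrableOn_exp_mul_inner_semigroup hβ u u),
      integral_mul_const, integral_exp_neg_mul hβ, hE.integral_exp_mul_inner_semigroup hβ,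
      real_inner_smul_left]
    field_simp
  have hle : ∫ r in Set.Ioi (0 : ℝ), Real.exp (-β * r) * inner ℝ (u - E.semigroup r u) u ≤
      ∫ r in Set.Ioi (0 : ℝ), c * (r * Real.exp (-β * r)) := by
    refine setIntegral_mono_on ?_ (hr.const_mul c) measurableSet_Ioi fun r hr0 => ?_
    · simp only [inner_sub_left, mul_sub]
      exact (hi.mul_const _).sub (hE.integrableOn_exp_mul_inner_semigroup hβ u u)
    · have h1 := h r hr0
      rw [inv_mul_le_iff₀ hr0] at h1
      nlinarith [mul_le_mul_of_nonneg_left h1 (Real.exp_pos (-β * r)).le]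
  rw [integral_const_mul, hr'] at hle
  rw [e]
  calc β * (β * _) ≤ β * (β * (c * (β ^ 2)⁻¹)) := by gcongr
    _ = c := by field_simp

end IsClosedForm

end L2Form
end DirichletParts

/-! ### Bounded forms and Mosco convergence of parts -/

namespace DirichletParts

namespace L2Form

variable {X : Type*} [MeasurableSpace X] {m : Measure X} {E : L2Form m}

theorem ofOperator_bilin (A : L2 m →L[ℝ] L2 m) (u v : (ofOperator A).domain) :
    (ofOperator A).bilin u v = inner ℝ (A u) (v : L2 m) := rfl

theorem isClosedForm_ofOperator {A : L2 m →L[ℝ] L2 m} (hA : IsSelfAdjoint A)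
    (hA0 : ∀ f, 0 ≤ inner ℝ (A f) f) : (ofOperator A).IsClosedForm where
  symm u v := by
    rw [ofOperator_bilin, ofOperator_bilin, real_inner_comm]
    exact ((ContinuousLinearMap.isSelfAdjoint_iff_isSymmetric.1 hA) _ _).symm
  nonneg u := hA0 u
  dense := dense_univ
  closed u hu := by
    have hle : ∀ w : (ofOperator A).domain, ‖(w : L2 m)‖ ^ 2 ≤ (ofOperator A).energyOne w :=
      fun w => le_add_of_nonneg_left (hA0 w)
    have hc : CauchySeq fun n => (u n : L2 m) := by
      refine Metric.cauchySeq_iff.2 fun ε hε => ?_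
      obtain ⟨N, hN⟩ := hu (ε ^ 2) (by positivity)
      refine ⟨N, fun k hk l hl => ?_⟩
      rw [dist_eq_norm]
      exact lt_of_pow_lt_pow_left₀ 2 hε.le ((hle (u k - u l)).trans_lt (hN k hk l hl))
    obtain ⟨v, hv⟩ := cauchySeq_tendsto_of_complete hc
    refine ⟨⟨v, Submodule.mem_top⟩, ?_⟩
    have h0 : Tendsto (fun n => (u n : L2 m) - v) atTop (𝓝 0) := by simpa using hv.sub_const v
    have h1 : Tendsto (fun n => inner ℝ (A ((u n : L2 m) - v)) ((u n : L2 m) - v) +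
        ‖(u n : L2 m) - v‖ ^ 2) atTop (𝓝 0) := by
      simpa using (((A.continuous.tendsto 0).comp h0).inner h0).add (h0.norm.pow 2)
    exact h1

theorem norm_resolvent_le (hE : E.IsClosedForm) {β : ℝ} (hβ : 0 < β) : ‖E.resolvent β‖ ≤ β⁻¹ := by
  refine ContinuousLinearMap.opNorm_le_bound _ (by positivity) fun f => ?_
  have := hE.norm_smul_resolvent_apply_le hβ f
  rwa [smul_apply, norm_smul, Real.norm_of_nonneg hβ.le, ← le_inv_mul_iff₀ hβ] at this

/-- The semigroup of a bounded form. -/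
theorem semigroup_ofOperator {A : L2 m →L[ℝ] L2 m} (hA : IsSelfAdjoint A)
    (hA0 : ∀ f, 0 ≤ inner ℝ (A f) f) (s : ℝ) :
    (ofOperator A).semigroup s = NormedSpace.exp (s • (-A)) := by
  let _ : NormedAlgebra ℚ (L2 m →L[ℝ] L2 m) := NormedAlgebra.restrictScalars ℚ ℝ _
  have hF := isClosedForm_ofOperator hA hA0
  refine semigroup_eq (isSemigroupAt_iff.2 fun f => ?_)
  have hK : ∀ β : ℝ, 0 < β →
      A * (ofOperator A).resolvent β + β • (ofOperator A).resolvent β = 1 := by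
    intro β hβ
    ext1 f
    refine ext_inner_right ℝ fun v => ?_
    have := hF.bilin_resolvent hβ f ⟨v, Submodule.mem_top⟩
    rw [ofOperator_bilin] at this
    simp only [add_apply, mul_apply_eq_comp, smul_apply, one_apply_eq_self, inner_add_left,
      real_inner_smul_left]
    exact this
  have hgen : Tendsto (fun β : ℝ => (ofOperator A).yosidaGen β) atTop (𝓝 (-A)) := by
    rw [tendsto_iff_norm_sub_tendsto_zero]
    have h0 : Tendsto (fun β : ℝ => ‖A * A‖ * β⁻¹) atTop (𝓝 0) := by
      simpa using (tendsto_inv_atTop_zero (𝕜 := ℝ)).const_mul ‖A * A‖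
    refine squeeze_zero' (Eventually.of_forall fun _ => norm_nonneg _) ?_ h0
    filter_upwards [eventually_gt_atTop (0 : ℝ)] with β hβ
    -- The error is `A² K_β`, of norm at most `‖A²‖ / β`: the Yosida generators converge even in
    -- operator norm.
    have e : (ofOperator A).yosidaGen β - -A = A * A * (ofOperator A).resolvent β := by
      have h1 := hK β hβ
      have h2 : β • (ofOperator A).resolvent β - 1 = -(A * (ofOperator A).resolvent β) := by
        rw [← h1]; abel
      have h3 : β • (ofOperator A).resolvent β = 1 - A * (ofOperator A).resolvent β := by
        rw [← h1]; abel
      rw [yosidaGen, h2, smul_neg, ← mul_smul_comm, h3, mul_sub, mul_one, mul_assoc]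
      abel
    rw [e]
    exact (norm_mul_le _ _).trans (by gcongr; exact norm_resolvent_le hF hβ)
  have hexp := (NormedSpace.exp_continuous (𝔸 := L2 m →L[ℝ] L2 m)).tendsto (s • (-A))
  exact ((ContinuousLinearMap.apply ℝ (L2 m) f).continuous.tendsto _).comp
    (hexp.comp (hgen.const_smul s))

theorem isSelfAdjoint_smul_one_sub {P : L2 m →L[ℝ] L2 m} (hP : IsSelfAdjoint P) (c : ℝ) :
    IsSelfAdjoint (c • (1 - P)) :=
  (IsSelfAdjoint.all c).smul ((IsSelfAdjoint.one _).sub hP)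

theorem inner_smul_one_sub_nonneg {P : L2 m →L[ℝ] L2 m} (hP : ∀ f, ‖P f‖ ≤ ‖f‖) {c : ℝ}
    (hc : 0 ≤ c) (f : L2 m) : 0 ≤ inner ℝ ((c • (1 - P)) f) f := by
  rw [smul_apply, real_inner_smul_left, sub_apply, one_apply_eq_self, inner_sub_left,
    real_inner_self_eq_norm_sq]
  refine mul_nonneg hc ?_
  nlinarith [real_inner_le_norm (P f) f, hP f, norm_nonneg f]

/-- The semigroup of the form `c (u - P u, u)`. -/
theorem semigroup_ofOperator_smul_one_sub {P : L2 m →L[ℝ] L2 m} (hP : IsSelfAdjoint P)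
    (hP1 : ∀ f, ‖P f‖ ≤ ‖f‖) {c : ℝ} (hc : 0 ≤ c) (s : ℝ) :
    (ofOperator (c • (1 - P))).semigroup s = NormedSpace.exp ((s * c) • (P - 1)) := by
  rw [semigroup_ofOperator (isSelfAdjoint_smul_one_sub hP c) (inner_smul_one_sub_nonneg hP1 hc),
    ← smul_neg, neg_sub, smul_smul]

/-- The functions vanishing a.e. off `Y`. -/
def supportedOn (m : Measure X) (Y : Set X) : Submodule ℝ (L2 m) where
  carrier := {u | ∀ᵐ x ∂m, x ∉ Y → (u : X → ℝ) x = 0}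
  zero_mem' := by
    filter_upwards [Lp.coeFn_zero ℝ 2 m] with x hx _ using hx
  add_mem' {u v} hu hv := by
    filter_upwards [hu, hv, Lp.coeFn_add u v] with x h1 h2 h3 hx
    rw [h3, Pi.add_apply, h1 hx, h2 hx, add_zero]
  smul_mem' c u hu := by
    filter_upwards [hu, Lp.coeFn_smul c u] with x h1 h2 hx
    rw [h2, Pi.smul_apply, h1 hx, smul_zero]

theorem exists_subseq_tendsto_ae {u : ℕ → L2 m} {v : L2 m} (h : Tendsto u atTop (𝓝 v)) :
    ∃ φ : ℕ → ℕ, StrictMono φ ∧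
      ∀ᵐ x ∂m, Tendsto (fun n => (u (φ n) : X → ℝ) x) atTop (𝓝 ((v : X → ℝ) x)) :=
  (tendstoInMeasure_of_tendsto_Lp h).exists_seq_tendsto_ae

theorem isClosed_supportedOn (Y : Set X) : IsClosed (supportedOn m Y : Set (L2 m)) := by
  refine IsSeqClosed.isClosed fun u v hu huv => ?_
  obtain ⟨φ, -, hφ⟩ := exists_subseq_tendsto_ae huv
  change ∀ᵐ x ∂m, x ∉ Y → (v : X → ℝ) x = 0
  filter_upwards [hφ, ae_all_iff.2 fun n => hu (φ n)] with x h1 h2 hx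
  refine tendsto_nhds_unique h1 ?_
  simp [h2 _ hx]

/-- A closed subspace is its double orthogonal complement, hence weakly closed. Membership for
infinitely many `n` suffices, which is what a strict bound on a lower limit provides. -/
theorem mem_supportedOn_of_weak_limit {Y : Set X} {u : ℕ → L2 m} {v : L2 m}
    (huv : ∀ w : L2 m, Tendsto (fun n => inner ℝ (u n) w) atTop (𝓝 (inner ℝ v w)))
    (hu : ∃ᶠ n in atTop, u n ∈ supportedOn m Y) : v ∈ supportedOn m Y := by
  have hc : CompleteSpace (supportedOn m Y) := (isClosed_supportedOn Y).completeSpace_coe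
  rw [← Submodule.orthogonal_orthogonal (supportedOn m Y), Submodule.mem_orthogonal']
  intro w hw
  refine isClosed_singleton.mem_of_frequently_of_tendsto (hu.mono fun n hn => ?_) (huv w)
  exact (Submodule.mem_orthogonal _ _).1 hw _ hn

theorem part_of_mem {Y : Set X} {u : L2 m} (h : u ∈ supportedOn m Y) : E.part Y u = E.value u :=
  if_pos h

theorem part_of_notMem {Y : Set X} {u : L2 m} (h : u ∉ supportedOn m Y) : E.part Y u = ⊤ :=
  if_neg h

theorem part_congr {Y Z : Set X} (h : Y =ᵐ[m] Z) : E.part Y = E.part Z := by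
  funext u
  have hiff : u ∈ supportedOn m Y ↔ u ∈ supportedOn m Z := by
    change (∀ᵐ x ∂m, x ∉ Y → (u : X → ℝ) x = 0) ↔ ∀ᵐ x ∂m, x ∉ Z → (u : X → ℝ) x = 0
    refine eventually_congr ?_
    filter_upwards [h.mem_iff] with x hx
    rw [hx]
  by_cases hu : u ∈ supportedOn m Y
  · rw [part_of_mem hu, part_of_mem (hiff.1 hu)]
  · rw [part_of_notMem hu, part_of_notMem (mt hiff.2 hu)]

theorem value_ofOperator (A : L2 m →L[ℝ] L2 m) (u : L2 m) :
    (ofOperator A).value u = ((inner ℝ (A u) u : ℝ) : EReal) :=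
  dif_pos Submodule.mem_top

theorem value_of_mem {u : L2 m} (h : u ∈ E.domain) :
    E.value u = ((E.bilin ⟨u, h⟩ ⟨u, h⟩ : ℝ) : EReal) := dif_pos h

theorem value_of_notMem {u : L2 m} (h : u ∉ E.domain) : E.value u = ⊤ := dif_neg h

/-- Mosco convergence of the parts on `Y` of bounded forms increasing to `E`. -/
theorem moscoConverges_part {Y : Set X} {A : ℕ → L2 m →L[ℝ] L2 m} (hA : ∀ n, IsSelfAdjoint (A n))
    (hA0 : ∀ n f, 0 ≤ inner ℝ (A n f) f)
    (hle : ∀ (n : ℕ) (u : E.domain), inner ℝ (A n u) (u : L2 m) ≤ E.bilin u u)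
    (hmem : ∀ (u : L2 m) (c : ℝ), (∀ n, inner ℝ (A n u) u ≤ c) →
      ∃ hu : u ∈ E.domain, E.bilin ⟨u, hu⟩ ⟨u, hu⟩ ≤ c)
    (hmono : ∀ k, ∀ᶠ n in atTop, ∀ u, inner ℝ (A k u) u ≤ inner ℝ (A n u) u) :
    MoscoConverges (fun n => (ofOperator (A n)).part Y) (E.part Y) where
  liminf_ge u v huv := by
    by_contra hlt
    push Not at hlt
    obtain ⟨c, hc1, hc2⟩ := EReal.lt_iff_exists_real_btwn.1 hlt
    have hfreq : ∃ᶠ n in atTop, (ofOperator (A n)).part Y (u n) < c :=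
      frequently_lt_of_liminf_lt (by isBoundedDefault) hc1
    have hfreq' : ∃ᶠ n in atTop, u n ∈ supportedOn m Y ∧ inner ℝ (A n (u n)) (u n) < c := by
      refine hfreq.mono fun n hn => ?_
      by_cases h : u n ∈ supportedOn m Y
      · rw [part_of_mem h, value_ofOperator] at hn
        exact ⟨h, EReal.coe_lt_coe_iff.1 hn⟩
      · rw [part_of_notMem h] at hn
        exact absurd hn not_top_lt
    have hv := mem_supportedOn_of_weak_limit huv (hfreq'.mono fun n h => h.1)
    -- Weak lower semicontinuity at a fixed level `k`: nonnegativity at `u n - v` gives `(A_k u_n,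
    -- u_n) ≥ 2 (u_n, A_k v) - (A_k v, v)`, whose right side converges to `(A_k v, v)`. Monotonicity
    -- keeps the left side below `c` infinitely often.
    obtain ⟨hvd, hvc⟩ := hmem v c fun k => by
      have hlim : Tendsto (fun n => 2 * inner ℝ (u n) (A k v) - inner ℝ (A k v) v) atTop
          (𝓝 (inner ℝ (A k v) v)) := by
        convert! ((huv (A k v)).const_mul 2).sub_const (inner ℝ (A k v) v) using 2
        rw [real_inner_comm v (A k v)]
        ring
      refine isClosed_Iic.mem_of_frequently_of_tendsto
        ((hfreq'.and_eventually (hmono k)).mono fun n hn => ?_) hlim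
      have h1 := hA0 k (u n - v)
      have h2 : inner ℝ (A k (u n)) v = inner ℝ (u n) (A k v) :=
        (ContinuousLinearMap.isSelfAdjoint_iff_isSymmetric.1 (hA k)) _ _
      rw [map_sub, inner_sub_left, inner_sub_right, inner_sub_right, h2,
        real_inner_comm (u n) (A k v)] at h1
      have h3 := hn.2 (u n)
      simp only [Set.mem_Iic]
      linarith [hn.1.2]
    rw [part_of_mem hv, value_of_mem hvd] at hc2
    exact absurd (EReal.coe_lt_coe_iff.1 hc2) (not_lt.2 hvc)
  exists_recovery v := by
    refine ⟨fun _ => v, tendsto_const_nhds, ?_⟩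
    by_cases h : v ∈ supportedOn m Y
    · by_cases hd : v ∈ E.domain
      · refine limsup_le_of_le (by isBoundedDefault) (Eventually.of_forall fun n => ?_)
        rw [part_of_mem h, part_of_mem h, value_ofOperator, value_of_mem hd]
        exact EReal.coe_le_coe_iff.2 (hle n ⟨v, hd⟩)
      · rw [part_of_mem h, value_of_notMem hd]
        exact le_top
    · rw [part_of_notMem h]
      exact le_top

theorem inner_timeApprox (E : L2Form m) (t : ℝ) (u : L2 m) :
    inner ℝ ((t⁻¹ • (1 - E.semigroup t)) u) u = t⁻¹ * inner ℝ (u - E.semigroup t u) u :=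
  real_inner_smul_left _ _ _

theorem inner_yosidaApprox (E : L2Form m) (β : ℝ) (u : L2 m) :
    inner ℝ ((β • (1 - β • E.resolvent β)) u) u = β * inner ℝ (u - β • E.resolvent β u) u :=
  real_inner_smul_left _ _ _

theorem IsClosedForm.moscoConverges_part_timeApprox (hE : E.IsClosedForm) (Y : Set X) {t : ℕ → ℝ}
    (ht : ∀ n, 0 < t n) (ht0 : Tendsto t atTop (𝓝 0)) :
    MoscoConverges (fun n => (E.timeApprox (t n)).part Y) (E.part Y) := by
  have hev : ∀ s : ℝ, 0 < s → ∀ᶠ n in atTop, t n ≤ s := fun s hs =>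
    ht0.eventually_le_const hs
  refine moscoConverges_part (fun n => isSelfAdjoint_smul_one_sub
    (hE.isSelfAdjoint_semigroup (ht n).le) _) (fun n => inner_smul_one_sub_nonneg
      (hE.norm_semigroup_apply_le (ht n).le) (inv_nonneg.2 (ht n).le)) ?_ ?_ ?_
  · intro n u
    rw [inner_timeApprox]
    exact hE.timeEnergy_le_bilin (ht n) u
  · intro u c h
    refine hE.mem_domain_of_timeEnergy_le u c fun s hs => ?_
    obtain ⟨n, hn⟩ := (hev s hs).exists
    refine (hE.timeEnergy_antitone (ht n) hn u).trans ?_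
    rw [← inner_timeApprox]
    exact h n
  · intro k
    filter_upwards [hev _ (ht k)] with n hn u
    rw [inner_timeApprox, inner_timeApprox]
    exact hE.timeEnergy_antitone (ht n) hn u

theorem IsClosedForm.moscoConverges_part_yosidaApprox (hE : E.IsClosedForm) (Y : Set X)
    {β : ℕ → ℝ} (hβ : ∀ n, 0 < β n) (hβ0 : Tendsto β atTop atTop) :
    MoscoConverges (fun n => (E.yosidaApprox (β n)).part Y) (E.part Y) := by
  refine moscoConverges_part (fun n => isSelfAdjoint_smul_one_sub
    ((IsSelfAdjoint.all _).smul (hE.isSelfAdjoint_resolvent (hβ n))) _)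
    (fun n => inner_smul_one_sub_nonneg (hE.norm_smul_resolvent_apply_le (hβ n)) (hβ n).le)
    ?_ ?_ ?_
  · intro n u
    rw [inner_yosidaApprox]
    exact hE.yosida_le_bilin (hβ n) u
  · intro u c h
    refine hE.mem_domain_of_yosida_le u c fun α hα => ?_
    obtain ⟨n, hn⟩ := (hβ0.eventually_ge_atTop α).exists
    refine (hE.yosida_mono hα hn u).trans ?_
    rw [← inner_yosidaApprox]
    exact h n
  · intro k
    filter_upwards [hβ0.eventually_ge_atTop (β k)] with n hn u
    rw [inner_yosidaApprox, inner_yosidaApprox]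
    exact hE.yosida_mono (hβ k) hn u

end L2Form
end DirichletParts

/-! ### Markovian operators and preservation of mass -/

namespace DirichletParts

variable {X : Type*} [MeasurableSpace X] {m : Measure X}

/-- The functions with values in `[0, c]`. -/
def band (m : Measure X) (c : ℝ) : Set (L2 m) := {f | ∀ᵐ x ∂m, 0 ≤ (f : X → ℝ) x ∧ (f : X → ℝ) x ≤ c}

/-- Operators mapping functions with values in `[0, 1]` to functions with values in `[0, 1]`. -/
def IsMarkovian (P : L2 m →L[ℝ] L2 m) : Prop := ∀ f ∈ band m 1, P f ∈ band m 1

theorem isClosed_band (c : ℝ) : IsClosed (band m c) := by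
  refine IsSeqClosed.isClosed fun u v hu huv => ?_
  obtain ⟨φ, -, hφ⟩ := L2Form.exists_subseq_tendsto_ae huv
  filter_upwards [hφ, ae_all_iff.2 fun n => hu (φ n)] with x h1 h2
  exact ⟨ge_of_tendsto' h1 fun n => (h2 n).1, le_of_tendsto' h1 fun n => (h2 n).2⟩

theorem band_mono {c d : ℝ} (h : c ≤ d) : band m c ⊆ band m d := by
  intro f hf
  change ∀ᵐ x ∂m, 0 ≤ (f : X → ℝ) x ∧ (f : X → ℝ) x ≤ d
  filter_upwards [hf] with x hx
  exact ⟨hx.1, hx.2.trans h⟩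

theorem add_mem_band {c d : ℝ} {f g : L2 m} (hf : f ∈ band m c) (hg : g ∈ band m d) :
    f + g ∈ band m (c + d) := by
  filter_upwards [hf, hg, Lp.coeFn_add f g] with x h1 h2 h3
  rw [h3, Pi.add_apply]
  exact ⟨add_nonneg h1.1 h2.1, add_le_add h1.2 h2.2⟩

theorem smul_mem_band {r : ℝ} (hr : 0 ≤ r) {f : L2 m} (hf : f ∈ band m 1) : r • f ∈ band m r := by
  filter_upwards [hf, Lp.coeFn_smul r f] with x h1 h3
  rw [h3, Pi.smul_apply, smul_eq_mul]
  exact ⟨mul_nonneg hr h1.1, mul_le_of_le_one_right hr h1.2⟩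

theorem zero_mem_band : (0 : L2 m) ∈ band m 0 := by
  filter_upwards [Lp.coeFn_zero ℝ 2 m] with x hx
  rw [hx]
  exact ⟨le_rfl, le_rfl⟩

theorem sum_smul_mem_band {ι : Type*} (s : Finset ι) {w : ι → ℝ} (hw : ∀ i, 0 ≤ w i)
    {f : ι → L2 m} (hf : ∀ i, f i ∈ band m 1) : ∑ i ∈ s, w i • f i ∈ band m (∑ i ∈ s, w i) := by
  classical
  induction s using Finset.induction_on with
  | empty => simpa using zero_mem_band
  | insert i s hi ih =>
    rw [Finset.sum_insert hi, Finset.sum_insert hi]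
    exact add_mem_band (smul_mem_band (hw i) (hf i)) ih

theorem hasSum_smul_mem_band {ι : Type*} {w : ι → ℝ} (hw : ∀ i, 0 ≤ w i) (hw1 : HasSum w 1)
    {f : ι → L2 m} (hf : ∀ i, f i ∈ band m 1) {g : L2 m} (hg : HasSum (fun i => w i • f i) g) :
    g ∈ band m 1 :=
  (isClosed_band 1).mem_of_tendsto hg (Eventually.of_forall fun s =>
    band_mono (sum_le_hasSum s (fun i _ => hw i) hw1) (sum_smul_mem_band s hw hf))

theorem indicatorConstLp_mem_band {s : Set X} (hs : MeasurableSet s) (hμ : m s ≠ ⊤) :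
    indicatorConstLp 2 hs hμ (1 : ℝ) ∈ band m 1 := by
  filter_upwards [indicatorConstLp_coeFn (p := 2) (hs := hs) (hμs := hμ) (c := (1 : ℝ))] with x hx
  rw [hx]
  by_cases h : x ∈ s <;> simp [h]

theorem inner_nonneg_of_mem_band {c d : ℝ} {f g : L2 m} (hf : f ∈ band m c) (hg : g ∈ band m d) :
    0 ≤ inner ℝ f g := by
  rw [L2.inner_def]
  refine integral_nonneg_of_ae ?_
  filter_upwards [hf, hg] with x h1 h2
  exact mul_nonneg h2.1 h1.1

namespace IsMarkovian

theorem pow {P : L2 m →L[ℝ] L2 m} (hP : IsMarkovian P) (n : ℕ) : IsMarkovian (P ^ n) := by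
  induction n with
  | zero => exact fun f hf => hf
  | succ n ih => rw [pow_succ']; exact fun f hf => hP _ (ih f hf)

theorem exp_smul_sub_one {P : L2 m →L[ℝ] L2 m} (hP : IsMarkovian P) {x : ℝ} (hx : 0 ≤ x) :
    IsMarkovian (NormedSpace.exp (x • (P - 1))) := fun f hf =>
  hasSum_smul_mem_band (fun n => by positivity) (hasSum_poissonWeight x) (fun n => hP.pow n f hf)
    (hasSum_exp_smul_sub_one_apply P x f)

end IsMarkovian

namespace L2Form

variable {E : L2Form m}

/-- Truncating the minimiser `p = β K_β f` to `[0, 1]` raises neither its energy nor its distance to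
`f`, which has values in `[0, 1]`. Uniqueness of the minimiser shows that `p` equals its truncation.
-/
theorem IsDirichletForm.isMarkovian_resolvent (hE : E.IsDirichletForm) {β : ℝ} (hβ : 0 < β) :
    IsMarkovian (β • E.resolvent β) := by
  intro f hf
  have hC := hE.isClosedForm
  obtain ⟨p, hp⟩ := hC.exists_coe_eq_smul_resolvent hβ f
  obtain ⟨w, hw, hwE⟩ := hE.markov p
  have h1 := hC.yosida_add_eq hβ f (v := w) hp
  have h2 := hC.yosida_eq hβ f hp
  have h3 : ‖f - w‖ ≤ ‖f - p‖ := by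
    refine Lp.norm_le_norm_of_ae_le ?_
    filter_upwards [hf, hw, Lp.coeFn_sub f (w : L2 m), Lp.coeFn_sub f (p : L2 m)] with x a b c d
    rw [c, d, Pi.sub_apply, Pi.sub_apply, b, Real.norm_eq_abs, Real.norm_eq_abs]
    rcases le_total ((p : L2 m) x) 0 with h | h
    · rw [max_eq_right h, min_eq_left zero_le_one, abs_of_nonneg (by linarith [a.1]),
        abs_of_nonneg (by linarith [a.1])]
      linarith
    · rw [max_eq_left h]
      rcases le_total ((p : L2 m) x) 1 with h' | h'
      · rw [min_eq_left h']
      · rw [min_eq_right h', abs_of_nonpos (by linarith [a.2]), abs_of_nonpos (by linarith [a.2])]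
        linarith
  have h4 : β * ‖f - w‖ ^ 2 ≤ β * ‖f - p‖ ^ 2 := by gcongr
  have h5 := hC.nonneg (w - p)
  have h6 : ‖(w : L2 m) - p‖ ^ 2 ≤ 0 := by
    by_contra h
    push Not at h
    have := mul_pos hβ h
    linarith
  have h7 : (w : L2 m) = p := by
    rw [← sub_eq_zero, ← norm_eq_zero]
    nlinarith [norm_nonneg ((w : L2 m) - p)]
  rw [smul_apply, ← hp, ← h7]
  filter_upwards [hw] with x hx
  rw [hx]
  exact ⟨le_min (le_max_right _ _) zero_le_one, min_le_right _ _⟩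

theorem IsDirichletForm.isMarkovian_semigroup (hE : E.IsDirichletForm) {t : ℝ} (ht : 0 ≤ t) :
    IsMarkovian (E.semigroup t) := by
  intro f hf
  refine (isClosed_band 1).mem_of_tendsto (hE.isClosedForm.tendsto_semigroup ht f) ?_
  filter_upwards [eventually_gt_atTop (0 : ℝ)] with β hβ
  rw [smul_yosidaGen]
  exact (hE.isMarkovian_resolvent hβ).exp_smul_sub_one (by positivity) f hf

end L2Form

theorem inner_symm_of_isSelfAdjoint {P : L2 m →L[ℝ] L2 m} (hP : IsSelfAdjoint P) (f g : L2 m) :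
    inner ℝ (P f) g = inner ℝ f (P g) :=
  (ContinuousLinearMap.isSelfAdjoint_iff_isSymmetric.1 hP) f g

section Mass

variable [SigmaFinite m]

/-- The indicator functions of the exhausting sets. -/
noncomputable def exhaust (m : Measure X) [SigmaFinite m] (k : ℕ) : L2 m :=
  indicatorConstLp 2 (measurableSet_spanningSets m k) (measure_spanningSets_lt_top m k).ne (1 : ℝ)

/-- `f` has integral `c`, in the sense of improper integrals along the exhausting sets. -/
def HasMass (f : L2 m) (c : ℝ) : Prop :=
  Tendsto (fun k => inner ℝ (exhaust m k) f) atTop (𝓝 c)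

theorem exhaust_mem_band (k : ℕ) : exhaust m k ∈ band m 1 := indicatorConstLp_mem_band _ _

theorem inner_exhaust (k : ℕ) (f : L2 m) :
    inner ℝ (exhaust m k) f = ∫ x in spanningSets m k, (f : X → ℝ) x ∂m :=
  L2.inner_indicatorConstLp_one _ _ f

theorem exhaust_sub_mem_band {k l : ℕ} (hkl : k ≤ l) : exhaust m l - exhaust m k ∈ band m 1 := by
  filter_upwards [Lp.coeFn_sub (exhaust m l) (exhaust m k),
    indicatorConstLp_coeFn (p := 2) (hs := measurableSet_spanningSets m k)
      (hμs := (measure_spanningSets_lt_top m k).ne) (c := (1 : ℝ)),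
    indicatorConstLp_coeFn (p := 2) (hs := measurableSet_spanningSets m l)
      (hμs := (measure_spanningSets_lt_top m l).ne) (c := (1 : ℝ))] with x h1 h2 h3
  rw [h1, Pi.sub_apply, exhaust, exhaust, h2, h3]
  by_cases hk : x ∈ spanningSets m k
  · simp [hk, monotone_spanningSets m hkl hk]
  · by_cases hl : x ∈ spanningSets m l <;> simp [hk, hl]

theorem monotone_inner_exhaust {f : L2 m} {c : ℝ} (hf : f ∈ band m c) :
    Monotone fun k => inner ℝ (exhaust m k) f := fun k l hkl => by
  have := inner_nonneg_of_mem_band (exhaust_sub_mem_band hkl) hf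
  rw [inner_sub_left] at this
  exact sub_nonneg.1 this

theorem HasMass.unique {f : L2 m} {c d : ℝ} (h : HasMass f c) (h' : HasMass f d) : c = d :=
  tendsto_nhds_unique h h'

theorem HasMass.inner_le {f g : L2 m} {c : ℝ} (h : HasMass f c) (hf : f ∈ band m 1)
    (hg : g ∈ band m 1) : inner ℝ g f ≤ c := by
  have hlim : Tendsto (fun k => ∫ x in spanningSets m k, inner ℝ ((g : X → ℝ) x) ((f : X → ℝ) x) ∂m)
      atTop (𝓝 (inner ℝ g f)) := by
    have := tendsto_setIntegral_of_monotone (μ := m) (s := spanningSets m)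
      (measurableSet_spanningSets m) (monotone_spanningSets m)
      (L2.integrable_inner (𝕜 := ℝ) g f).integrableOn
    rwa [iUnion_spanningSets, setIntegral_univ, ← L2.inner_def] at this
  refine le_of_tendsto_of_tendsto' hlim h fun k => ?_
  rw [inner_exhaust]
  refine setIntegral_mono_ae (L2.integrable_inner (𝕜 := ℝ) g f).integrableOn
    (integrableOn_Lp_of_measure_ne_top f one_le_two (measure_spanningSets_lt_top m k).ne) ?_
  filter_upwards [hf, hg] with x h1 h2
  simp only [RCLike.inner_apply, conj_trivial]
  exact mul_le_of_le_one_right h1.1 h2.2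

/-- Symmetry moves `P` onto the indicator, whose image still has values in `[0, 1]`; hence `P`
cannot increase mass. -/
theorem HasMass.inner_exhaust_apply_le {P : L2 m →L[ℝ] L2 m} (hP : IsSelfAdjoint P)
    (hPM : IsMarkovian P) {f : L2 m} {c : ℝ} (h : HasMass f c) (hf : f ∈ band m 1) (k : ℕ) :
    inner ℝ (exhaust m k) (P f) ≤ c := by
  rw [← inner_symm_of_isSelfAdjoint hP]
  exact h.inner_le hf (hPM _ (exhaust_mem_band k))

theorem HasMass.exists_apply {P : L2 m →L[ℝ] L2 m} (hP : IsSelfAdjoint P) (hPM : IsMarkovian P)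
    {f : L2 m} {c : ℝ} (h : HasMass f c) (hf : f ∈ band m 1) : ∃ d ≤ c, HasMass (P f) d := by
  have hb : BddAbove (Set.range fun k => inner ℝ (exhaust m k) (P f)) :=
    ⟨c, by rintro _ ⟨k, rfl⟩; exact h.inner_exhaust_apply_le hP hPM hf k⟩
  exact ⟨_, ciSup_le fun k => h.inner_exhaust_apply_le hP hPM hf k,
    tendsto_atTop_ciSup (monotone_inner_exhaust (hPM f hf)) hb⟩

theorem hasMass_indicatorConstLp {B : Set X} (hB : MeasurableSet B) (hμ : m B ≠ ⊤) :
    HasMass (indicatorConstLp 2 hB hμ (1 : ℝ)) (m.real B) := by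
  have h := tendsto_setIntegral_of_monotone (μ := m) (s := spanningSets m)
      (measurableSet_spanningSets m) (monotone_spanningSets m)
      (integrable_indicatorConstLp (p := 2) hB hμ (1 : ℝ)).integrableOn
  rw [iUnion_spanningSets, setIntegral_univ, integral_indicatorConstLp, smul_eq_mul, mul_one] at h
  exact h.congr fun k => (inner_exhaust k _).symm

/-- `P 1 = 1` a.e. on `B` if and only if `P` preserves the integral of `1_B`. -/
theorem iSup_eq_one_iff_hasMass {P : L2 m →L[ℝ] L2 m} (hP : IsSelfAdjoint P) (hPM : IsMarkovian P)
    {B : Set X} (hB : MeasurableSet B) (hμ : m B ≠ ⊤) :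
    (∀ᵐ x ∂m, x ∈ B → ⨆ k, ((P (exhaust m k) : X → ℝ) x : EReal) = 1) ↔
      HasMass (P (indicatorConstLp 2 hB hμ (1 : ℝ))) (m.real B) := by
  have hmono : ∀ᵐ x ∂m, Monotone fun k => (P (exhaust m k) : X → ℝ) x := by
    have : ∀ᵐ x ∂m, ∀ k, (P (exhaust m k) : X → ℝ) x ≤ (P (exhaust m (k + 1)) : X → ℝ) x := by
      refine ae_all_iff.2 fun k => ?_
      have h := hPM _ (exhaust_sub_mem_band (m := m) (Nat.le_succ k))
      rw [map_sub] at h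
      filter_upwards [h, Lp.coeFn_sub (P (exhaust m (k + 1))) (P (exhaust m k))] with x h1 h2
      rw [h2, Pi.sub_apply] at h1
      exact sub_nonneg.1 h1.1
    exact this.mono fun x hx => monotone_nat_of_le_succ hx
  have hband : ∀ᵐ x ∂m, ∀ k, 0 ≤ (P (exhaust m k) : X → ℝ) x ∧ (P (exhaust m k) : X → ℝ) x ≤ 1 :=
    ae_all_iff.2 fun k => hPM _ (exhaust_mem_band k)
  have hlim : ∀ᵐ x ∂m, Tendsto (fun k => (P (exhaust m k) : X → ℝ) x) atTop
      (𝓝 (⨆ k, (P (exhaust m k) : X → ℝ) x)) := by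
    filter_upwards [hmono, hband] with x h1 h2
    exact tendsto_atTop_ciSup h1 ⟨1, by rintro _ ⟨k, rfl⟩; exact (h2 k).2⟩
  have hone : ∀ᵐ x ∂m, (⨆ k, ((P (exhaust m k) : X → ℝ) x : EReal) = 1 ↔
      1 - ⨆ k, (P (exhaust m k) : X → ℝ) x = 0) := by
    filter_upwards [hmono, hlim] with x h1 h2
    have h3 : ⨆ k, ((P (exhaust m k) : X → ℝ) x : EReal) =
        ((⨆ k, (P (exhaust m k) : X → ℝ) x : ℝ) : EReal) :=
      iSup_eq_of_tendsto (fun k l hkl => EReal.coe_le_coe_iff.2 (h1 hkl)) (EReal.tendsto_coe.2 h2)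
    rw [h3, ← EReal.coe_one, EReal.coe_eq_coe_iff, sub_eq_zero, eq_comm]
  set g : X → ℝ := fun x => ⨆ k, (P (exhaust m k) : X → ℝ) x with hg
  have hgm : AEStronglyMeasurable g m :=
    aestronglyMeasurable_of_tendsto_ae atTop (fun k => Lp.aestronglyMeasurable _) hlim
  have hg01 : ∀ᵐ x ∂m, 0 ≤ g x ∧ g x ≤ 1 := by
    filter_upwards [hband, hlim] with x h1 h2
    exact ⟨ge_of_tendsto' h2 fun k => (h1 k).1, le_of_tendsto' h2 fun k => (h1 k).2⟩
  have hfin : IsFiniteMeasure (m.restrict B) := ⟨by simpa using hμ.lt_top⟩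
  have hgi : IntegrableOn g B m := by
    refine Integrable.mono' (integrable_const (1 : ℝ)) hgm.restrict (ae_restrict_of_ae ?_)
    filter_upwards [hg01] with x hx
    rw [Real.norm_of_nonneg hx.1]
    exact hx.2
  -- With `g = P 1`, symmetry identifies the mass of `P 1_B` as `∫_B g`. The lost mass is then `∫_B
  -- (1 - g)`, which has a nonnegative integrand and vanishes iff `g = 1` a.e. on `B`.
  have hmass : HasMass (P (indicatorConstLp 2 hB hμ (1 : ℝ))) (∫ x in B, g x ∂m) := by
    have h : Tendsto (fun k => ∫ x in B, (P (exhaust m k) : X → ℝ) x ∂m) atTop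
        (𝓝 (∫ x in B, g x ∂m)) := by
      refine tendsto_integral_of_dominated_convergence (fun _ => (1 : ℝ))
        (fun k => (Lp.aestronglyMeasurable _).restrict) (integrable_const _) (fun k => ?_)
        (ae_restrict_of_ae hlim)
      refine ae_restrict_of_ae ?_
      filter_upwards [hband] with x hx
      rw [Real.norm_of_nonneg (hx k).1]
      exact (hx k).2
    refine h.congr fun k => ?_
    rw [← L2.inner_indicatorConstLp_one hB hμ, real_inner_comm, inner_symm_of_isSelfAdjoint hP]
  have hint : ∫ x in B, (1 - g x) ∂m = m.real B - ∫ x in B, g x ∂m := by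
    rw [integral_sub (integrable_const _) hgi]
    simp
  have hzero := integral_eq_zero_iff_of_nonneg_ae (μ := m.restrict B) (f := fun x => 1 - g x)
    (ae_restrict_of_ae (hg01.mono fun x hx => sub_nonneg.2 hx.2)) ((integrable_const _).sub hgi)
  have hiff : HasMass (P (indicatorConstLp 2 hB hμ (1 : ℝ))) (m.real B) ↔
      ∫ x in B, (1 - g x) ∂m = 0 := by
    rw [hint, sub_eq_zero]
    exact ⟨fun h => h.unique hmass, fun h => h ▸ hmass⟩
  rw [hiff, hzero, EventuallyEq, ae_restrict_iff' hB]
  refine eventually_congr ?_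
  filter_upwards [hone] with x hx
  rw [hx]
  rfl

/-- A Poisson mixture of the powers of `P` preserves the mass of `f` if and only if all the powers
do. -/
theorem hasMass_exp_smul_sub_one_iff {P : L2 m →L[ℝ] L2 m} (hP : IsSelfAdjoint P)
    (hPM : IsMarkovian P) {f : L2 m} {c : ℝ} (h : HasMass f c) (hf : f ∈ band m 1) {x : ℝ}
    (hx : 0 < x) :
    HasMass (NormedSpace.exp (x • (P - 1)) f) c ↔ ∀ n : ℕ, HasMass ((P ^ n) f) c := by
  set w : ℕ → ℝ := fun n => Real.exp (-x) * (x ^ n / n.factorial) with hw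
  have hw0 : ∀ n, 0 < w n := fun n => by positivity
  have hw1 : HasSum w 1 := hasSum_poissonWeight x
  have hd0 : ∀ n k, 0 ≤ c - inner ℝ (exhaust m k) ((P ^ n) f) := fun n k =>
    sub_nonneg.2 (h.inner_exhaust_apply_le (hP.pow n) (hPM.pow n) hf k)
  have hdc : ∀ n k, c - inner ℝ (exhaust m k) ((P ^ n) f) ≤ c := fun n k =>
    sub_le_self _ (inner_nonneg_of_mem_band (exhaust_mem_band k) (hPM.pow n f hf))
  -- The deficit of the exponential on each exhausting set is the Poisson average of the deficits of
  -- the powers, all nonnegative. A single term bounds each power's deficit because its weight is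
  -- positive; conversely dominated convergence applies with bound `w n * c`.
  have hsum : ∀ k, HasSum (fun n => w n * (c - inner ℝ (exhaust m k) ((P ^ n) f)))
      (c - inner ℝ (exhaust m k) (NormedSpace.exp (x • (P - 1)) f)) := by
    intro k
    have h1 := (hasSum_exp_smul_sub_one_apply P x f).mapL (innerSL ℝ (exhaust m k))
    simp only [innerSL_apply_apply, real_inner_smul_right] at h1
    have h2 := (hw1.mul_right c).sub h1
    rw [one_mul] at h2
    convert! h2 using 2 with n
    rw [mul_sub]
  have hiff : ∀ g : L2 m, HasMass g c ↔
      Tendsto (fun k => c - inner ℝ (exhaust m k) g) atTop (𝓝 0) := by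
    intro g
    constructor
    · intro hg
      have := Tendsto.const_sub c hg
      rwa [sub_self] at this
    · intro hg
      have := hg.const_sub c
      simp only [sub_sub_cancel, sub_zero] at this
      exact this
  simp only [hiff]
  constructor
  · intro hS n
    have h0 : Tendsto (fun k => (w n)⁻¹ *
        (c - inner ℝ (exhaust m k) (NormedSpace.exp (x • (P - 1)) f))) atTop (𝓝 0) := by
      simpa using hS.const_mul (w n)⁻¹
    refine squeeze_zero (hd0 n) (fun k => ?_) h0
    rw [le_inv_mul_iff₀ (hw0 n)]
    exact le_hasSum (hsum k) n fun i _ => mul_nonneg (hw0 i).le (hd0 i k)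
  · intro hn
    have h0 := tendsto_tsum_of_dominated_convergence (𝓕 := atTop) (bound := fun n => w n * c)
      (f := fun k n => w n * (c - inner ℝ (exhaust m k) ((P ^ n) f))) (g := fun _ => 0)
      (hw1.mul_right c).summable (fun n => by simpa using (hn n).const_mul (w n))
      (Eventually.of_forall fun k n => by
        rw [Real.norm_of_nonneg (mul_nonneg (hw0 n).le (hd0 n k))]
        exact mul_le_mul_of_nonneg_left (hdc n k) (hw0 n).le)
    rw [tsum_zero] at h0
    exact h0.congr fun k => (hsum k).tsum_eq

end Mass

end DirichletParts

/-! ### The conservative spaces of the form and of its approximations -/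

namespace DirichletParts

namespace L2Form

variable {X : Type*} [MeasurableSpace X] {m : Measure X} [SigmaFinite m] {E : L2Form m}

namespace IsDirichletForm

theorem exists_hasMass_semigroup (hE : E.IsDirichletForm) {f : L2 m} {c : ℝ} (h : HasMass f c)
    (hf : f ∈ band m 1) {t : ℝ} (ht : 0 ≤ t) : ∃ d ≤ c, HasMass (E.semigroup t f) d :=
  h.exists_apply (hE.isClosedForm.isSelfAdjoint_semigroup ht) (hE.isMarkovian_semigroup ht) hf

/-- Since `T_t = T_{t-s} T_s` and neither factor increases mass, mass lost by time `s` is not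
regained by time `t`. -/
theorem hasMass_semigroup_of_le (hE : E.IsDirichletForm) {f : L2 m} {c : ℝ} (h : HasMass f c)
    (hf : f ∈ band m 1) {s t : ℝ} (hs : 0 ≤ s) (hst : s ≤ t) (ht : HasMass (E.semigroup t f) c) :
    HasMass (E.semigroup s f) c := by
  obtain ⟨d, hd, hsd⟩ := hE.exists_hasMass_semigroup h hf hs
  obtain ⟨e, he, hte⟩ := hE.exists_hasMass_semigroup hsd (hE.isMarkovian_semigroup hs f hf)
    (sub_nonneg.2 hst)
  rw [← mul_apply_eq_comp, ← hE.isClosedForm.semigroup_add (sub_nonneg.2 hst) hs,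
    sub_add_cancel] at hte
  have hce := ht.unique hte
  rwa [le_antisymm hd (hce.trans_le he)] at hsd

theorem inner_exhaust_smul_resolvent (hE : E.IsDirichletForm) {β : ℝ} (hβ : 0 < β) (f : L2 m)
    (k : ℕ) : inner ℝ (exhaust m k) ((β • E.resolvent β) f) =
      β * ∫ r in Set.Ioi (0 : ℝ), Real.exp (-β * r) * inner ℝ (exhaust m k) (E.semigroup r f) := by
  simp only [real_inner_comm (E.semigroup _ f) (exhaust m k)]
  rw [hE.isClosedForm.integral_exp_mul_inner_semigroup hβ, smul_apply, real_inner_smul_right,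
    real_inner_comm]

/-- The masses of the Laplace transforms converge to the Laplace transform of the masses. -/
theorem hasMass_smul_resolvent_integral (hE : E.IsDirichletForm) {β : ℝ} (hβ : 0 < β) {f : L2 m}
    {c : ℝ} (h : HasMass f c) (hf : f ∈ band m 1) {d : ℝ → ℝ}
    (hd : ∀ r, 0 ≤ r → HasMass (E.semigroup r f) (d r)) :
    HasMass ((β • E.resolvent β) f) (β * ∫ r in Set.Ioi (0 : ℝ), Real.exp (-β * r) * d r) := by
  have hC := hE.isClosedForm
  refine Tendsto.congr (fun k => (hE.inner_exhaust_smul_resolvent hβ f k).symm) ?_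
  refine Tendsto.const_mul _ (tendsto_integral_of_dominated_convergence
    (fun r => Real.exp (-β * r) * c) (fun k => ?_)
    ((exp_neg_integrableOn_Ioi 0 hβ).mul_const c) (fun k => ?_) ?_)
  · have := (hC.integrableOn_exp_mul_inner_semigroup hβ f (exhaust m k)).aestronglyMeasurable
    simpa only [real_inner_comm (E.semigroup _ f) (exhaust m k)] using this
  · filter_upwards [ae_restrict_mem measurableSet_Ioi] with r hr
    have hr' : 0 ≤ r := le_of_lt hr
    have h0 := inner_nonneg_of_mem_band (exhaust_mem_band (m := m) k)
      (hE.isMarkovian_semigroup hr' f hf)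
    rw [Real.norm_of_nonneg (mul_nonneg (Real.exp_pos _).le h0)]
    exact mul_le_mul_of_nonneg_left (h.inner_exhaust_apply_le (hC.isSelfAdjoint_semigroup hr')
      (hE.isMarkovian_semigroup hr') hf k) (Real.exp_pos _).le
  · filter_upwards [ae_restrict_mem measurableSet_Ioi] with r hr
    exact Tendsto.const_mul _ (hd r (le_of_lt hr))

theorem hasMass_smul_resolvent (hE : E.IsDirichletForm) {β : ℝ} (hβ : 0 < β) {f : L2 m}
    {c : ℝ} (hf : f ∈ band m 1) (h : ∀ r, 0 ≤ r → HasMass (E.semigroup r f) c) :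
    HasMass ((β • E.resolvent β) f) c := by
  have h0 : HasMass f c := by
    have := h 0 le_rfl
    rwa [hE.isClosedForm.semigroup_zero] at this
  have h1 := hE.hasMass_smul_resolvent_integral hβ h0 hf h
  rwa [integral_mul_const, IsClosedForm.integral_exp_neg_mul hβ, ← mul_assoc,
    mul_inv_cancel₀ hβ.ne', one_mul] at h1

/-- The mass `d r` of `T_r f` is at most `c`, and its average against `β e^{-βr}` equals `c`, so `d
r = c` for almost every `r`. Some such `r` exceeds `s`, and mass decreases in time. -/
theorem hasMass_semigroup_of_resolvent (hE : E.IsDirichletForm) {β : ℝ} (hβ : 0 < β) {f : L2 m}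
    {c : ℝ} (h : HasMass f c) (hf : f ∈ band m 1) (hK : HasMass ((β • E.resolvent β) f) c) (s : ℝ)
    (hs : 0 ≤ s) : HasMass (E.semigroup s f) c := by
  have hC := hE.isClosedForm
  choose! d hdc hd using fun (r : ℝ) (hr : 0 ≤ r) => hE.exists_hasMass_semigroup h hf hr
  have h1 := hK.unique (hE.hasMass_smul_resolvent_integral hβ h hf hd)
  have hi := exp_neg_integrableOn_Ioi 0 hβ
  have hd0 : ∀ r, 0 ≤ r → 0 ≤ d r := fun r hr => ge_of_tendsto' (hd r hr) fun k =>
    inner_nonneg_of_mem_band (exhaust_mem_band k) (hE.isMarkovian_semigroup hr f hf)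
  have hdm : AEStronglyMeasurable d (volume.restrict (Set.Ioi 0)) := by
    refine aestronglyMeasurable_of_tendsto_ae (u := (atTop : Filter ℕ))
      (f := fun k r => inner ℝ (E.semigroup r f) (exhaust m k))
      (fun k => hC.aestronglyMeasurable_inner_semigroup f _) ?_
    filter_upwards [ae_restrict_mem measurableSet_Ioi] with r hr
    exact (hd r (le_of_lt hr)).congr fun k => real_inner_comm _ _
  have hid : IntegrableOn (fun r => Real.exp (-β * r) * d r) (Set.Ioi 0) := by
    refine Integrable.mono' (hi.mul_const c) (hi.aestronglyMeasurable.mul hdm) ?_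
    filter_upwards [ae_restrict_mem measurableSet_Ioi] with r hr
    have hr' : 0 ≤ r := le_of_lt hr
    rw [Real.norm_of_nonneg (mul_nonneg (Real.exp_pos _).le (hd0 r hr'))]
    exact mul_le_mul_of_nonneg_left (hdc r hr') (Real.exp_pos _).le
  have hzero : ∫ r in Set.Ioi (0 : ℝ), (Real.exp (-β * r) * c - Real.exp (-β * r) * d r) = 0 := by
    rw [integral_sub (hi.mul_const c) hid, integral_mul_const,
      IsClosedForm.integral_exp_neg_mul hβ, sub_eq_zero]
    nth_rewrite 1 [h1]
    rw [← mul_assoc, inv_mul_cancel₀ hβ.ne', one_mul]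
  have hnn : 0 ≤ᵐ[volume.restrict (Set.Ioi (0 : ℝ))]
      fun r => Real.exp (-β * r) * c - Real.exp (-β * r) * d r := by
    filter_upwards [ae_restrict_mem measurableSet_Ioi] with r hr
    exact sub_nonneg.2 (mul_le_mul_of_nonneg_left (hdc r (le_of_lt hr)) (Real.exp_pos _).le)
  have hae := (integral_eq_zero_iff_of_nonneg_ae hnn ((hi.mul_const c).sub hid)).1 hzero
  rw [EventuallyEq, ae_restrict_iff' measurableSet_Ioi] at hae
  obtain ⟨r, hr, hsr⟩ : ∃ r, d r = c ∧ s < r := by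
    by_contra hcon
    push Not at hcon
    have : volume (Set.Ioi s) = 0 := by
      refine measure_mono_null (fun r (hr : s < r) => ?_) hae
      intro hr0
      have h2 := hr0 (hs.trans_lt hr)
      rw [← mul_sub, Pi.zero_apply, mul_eq_zero, or_iff_right (Real.exp_pos _).ne',
        sub_eq_zero] at h2
      exact absurd hr (not_lt.2 (hcon r h2.symm))
    simp at this
  have h3 := hd r (hs.trans hsr.le)
  rw [hr] at h3
  exact hE.hasMass_semigroup_of_le h hf hs hsr.le h3

/-- If the semigroup preserves the mass of `f`, then so do the powers of `β K_β`. -/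
theorem hasMass_pow_smul_resolvent (hE : E.IsDirichletForm) {β : ℝ} (hβ : 0 < β) {f : L2 m}
    {c : ℝ} (hf : f ∈ band m 1) (h : ∀ r, 0 ≤ r → HasMass (E.semigroup r f) c) (n : ℕ) :
    HasMass (((β • E.resolvent β) ^ n) f) c := by
  have hC := hE.isClosedForm
  -- The induction must carry all later times, since one step with `β K_β` requires the mass to be
  -- preserved along the whole semigroup.
  suffices ∀ r, 0 ≤ r → HasMass (E.semigroup r (((β • E.resolvent β) ^ n) f)) c by
    have := this 0 le_rfl
    rwa [hC.semigroup_zero] at this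
  induction n with
  | zero => exact h
  | succ n ih =>
    intro r hr
    set g := ((β • E.resolvent β) ^ n) f with hg
    have hgb : g ∈ band m 1 := (hE.isMarkovian_resolvent hβ).pow n f hf
    have hcomm : E.semigroup r ((β • E.resolvent β) g) = (β • E.resolvent β) (E.semigroup r g) :=
      congrArg (fun L : L2 m →L[ℝ] L2 m => L g)
        ((hC.commute_resolvent_semigroup hβ hr).smul_left β).eq.symm
    rw [pow_succ', mul_apply_eq_comp, ← hg, hcomm]
    refine hE.hasMass_smul_resolvent hβ (hE.isMarkovian_semigroup hr g hgb) fun s hs => ?_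
    rw [← mul_apply_eq_comp, ← hC.semigroup_add hs hr]
    exact ih _ (add_nonneg hs hr)

/-- Mass decreases in time, so arbitrarily late times decide. It serves for the times `k + 1` of
`consSpace` and for the multiples `n t`. -/
theorem hasMass_semigroup_nat_iff (hE : E.IsDirichletForm) {f : L2 m} {c : ℝ} (h : HasMass f c)
    (hf : f ∈ band m 1) {a : ℕ → ℝ} (ha0 : ∀ n, 0 ≤ a n) (ha : Tendsto a atTop atTop) :
    (∀ n, HasMass (E.semigroup (a n) f) c) ↔ ∀ r, 0 ≤ r → HasMass (E.semigroup r f) c := by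
  refine ⟨fun H r hr => ?_, fun H n => H _ (ha0 n)⟩
  obtain ⟨n, hn⟩ := (ha.eventually_ge_atTop r).exists
  exact hE.hasMass_semigroup_of_le h hf hr hn (H n)

end IsDirichletForm

/-- Only symmetry and the Markov property of the semigroup at these times enter, so the criterion
applies to the approximating forms as well. -/
theorem ae_mem_consSpace_iff (hT : ∀ k : ℕ, IsSelfAdjoint (E.semigroup ((k : ℝ) + 1)))
    (hTM : ∀ k : ℕ, IsMarkovian (E.semigroup ((k : ℝ) + 1))) {B : Set X} (hB : MeasurableSet B)
    (hμ : m B ≠ ⊤) : (∀ᵐ x ∂m, x ∈ B → x ∈ E.consSpace) ↔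
      ∀ k : ℕ, HasMass (E.semigroup ((k : ℝ) + 1) (indicatorConstLp 2 hB hμ (1 : ℝ)))
        (m.real B) := by
  simp only [← iSup_eq_one_iff_hasMass (hT _) (hTM _) hB hμ, ← ae_all_iff]
  refine eventually_congr (Eventually.of_forall fun x => ?_)
  simp only [consSpace, Set.mem_iInter]
  exact ⟨fun H k hx => H hx k, fun H hx k => H k hx⟩

theorem measurableSet_consSpace (E : L2Form m) : MeasurableSet E.consSpace := by
  refine MeasurableSet.iInter fun k => measurableSet_eq_fun ?_ measurable_const
  exact Measurable.iSup fun j => (Lp.stronglyMeasurable _).measurable.coe_real_ereal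

/-- The mass criterion tests only sets of finite measure; by σ-finiteness the pieces `A ∩
spanningSets m k` are enough. -/
theorem ae_le_of_forall_finite {A B : Set X} (hA : MeasurableSet A)
    (h : ∀ C, MeasurableSet C → m C ≠ ⊤ → (∀ᵐ x ∂m, x ∈ C → x ∈ A) → ∀ᵐ x ∂m, x ∈ C → x ∈ B) :
    A ≤ᵐ[m] B := by
  have h1 : ∀ᵐ x ∂m, ∀ k, x ∈ A ∩ spanningSets m k → x ∈ B :=
    ae_all_iff.2 fun k => h _ (hA.inter (measurableSet_spanningSets m k))
      ((measure_mono Set.inter_subset_right).trans_lt (measure_spanningSets_lt_top m k)).ne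
      (Eventually.of_forall fun x hx => hx.1)
  filter_upwards [h1] with x hx hxA
  obtain ⟨k, hk⟩ := Set.mem_iUnion.1 ((iUnion_spanningSets m).symm ▸ Set.mem_univ x)
  exact hx k ⟨hxA, hk⟩

namespace IsDirichletForm

theorem ae_mem_consSpace_iff (hE : E.IsDirichletForm) {B : Set X} (hB : MeasurableSet B)
    (hμ : m B ≠ ⊤) : (∀ᵐ x ∂m, x ∈ B → x ∈ E.consSpace) ↔
      ∀ r, 0 ≤ r → HasMass (E.semigroup r (indicatorConstLp 2 hB hμ (1 : ℝ))) (m.real B) := by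
  rw [L2Form.ae_mem_consSpace_iff
    (fun k => hE.isClosedForm.isSelfAdjoint_semigroup (by positivity))
    (fun k => hE.isMarkovian_semigroup (by positivity)) hB hμ]
  exact hE.hasMass_semigroup_nat_iff (hasMass_indicatorConstLp hB hμ)
    (indicatorConstLp_mem_band hB hμ) (fun n => by positivity)
    (tendsto_atTop_add_const_right atTop (1 : ℝ) tendsto_natCast_atTop_atTop)

/-- The conservative space of `E` is that of `c (u - P u, u)`, if `P` detects conservativeness. -/
theorem consSpace_ofOperator (hE : E.IsDirichletForm) {P : L2 m →L[ℝ] L2 m}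
    (hP : IsSelfAdjoint P) (hP1 : ∀ f, ‖P f‖ ≤ ‖f‖) (hPM : IsMarkovian P) {c : ℝ} (hc : 0 < c)
    (hiff : ∀ (f : L2 m) (a : ℝ), HasMass f a → f ∈ band m 1 →
      ((∀ n : ℕ, HasMass ((P ^ n) f) a) ↔ ∀ r, 0 ≤ r → HasMass (E.semigroup r f) a)) :
    (ofOperator (c • (1 - P))).consSpace =ᵐ[m] E.consSpace := by
  have hS := semigroup_ofOperator_smul_one_sub hP hP1 hc.le
  have key : ∀ B, MeasurableSet B → m B ≠ ⊤ →
      ((∀ᵐ x ∂m, x ∈ B → x ∈ (ofOperator (c • (1 - P))).consSpace) ↔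
        ∀ᵐ x ∂m, x ∈ B → x ∈ E.consSpace) := by
    intro B hB hμ
    have hm := hasMass_indicatorConstLp hB hμ
    have hb := indicatorConstLp_mem_band hB hμ
    have hpos : ∀ k : ℕ, 0 < ((k : ℝ) + 1) * c := fun k => by positivity
    rw [hE.ae_mem_consSpace_iff hB hμ, L2Form.ae_mem_consSpace_iff (fun k => ?_) (fun k => ?_) hB hμ]
    -- The Poisson criterion does not depend on the positive parameter `(k + 1) c`, so the
    -- quantifier over `k` disappears.
    · simp only [hS, hasMass_exp_smul_sub_one_iff hP hPM hm hb (hpos _), forall_const]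
      exact hiff _ _ hm hb
    · rw [hS]
      exact ((IsSelfAdjoint.all _).smul (hP.sub (IsSelfAdjoint.one _))).exp
    · rw [hS]
      exact hPM.exp_smul_sub_one (hpos k).le
  exact (ae_le_of_forall_finite (measurableSet_consSpace _) fun B hB hμ => (key B hB hμ).1).antisymm
    (ae_le_of_forall_finite (measurableSet_consSpace _) fun B hB hμ => (key B hB hμ).2)

theorem consSpace_timeApprox (hE : E.IsDirichletForm) {t : ℝ} (ht : 0 < t) :
    (E.timeApprox t).consSpace =ᵐ[m] E.consSpace := by
  refine hE.consSpace_ofOperator (hE.isClosedForm.isSelfAdjoint_semigroup ht.le)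
    (hE.isClosedForm.norm_semigroup_apply_le ht.le) (hE.isMarkovian_semigroup ht.le)
    (inv_pos.2 ht) fun f a hm hf => ?_
  simp only [← hE.isClosedForm.semigroup_nat_mul ht.le]
  exact hE.hasMass_semigroup_nat_iff hm hf (fun n => by positivity)
    (tendsto_natCast_atTop_atTop.atTop_mul_const ht)

theorem consSpace_yosidaApprox (hE : E.IsDirichletForm) {β : ℝ} (hβ : 0 < β) :
    (E.yosidaApprox β).consSpace =ᵐ[m] E.consSpace := by
  refine hE.consSpace_ofOperator
    ((IsSelfAdjoint.all β).smul (hE.isClosedForm.isSelfAdjoint_resolvent hβ))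
    (hE.isClosedForm.norm_smul_resolvent_apply_le hβ) (hE.isMarkovian_resolvent hβ) hβ
    fun f a hm hf => ⟨fun H => ?_, fun H => hE.hasMass_pow_smul_resolvent hβ hf H⟩
  -- The first power of `β K_β` alone already forces the semigroup to preserve the mass.
  exact hE.hasMass_semigroup_of_resolvent hβ hm hf (by simpa using H 1)

end IsDirichletForm

end L2Form

end DirichletParts

theorem mainTheorem9 {X : Type*} [MeasurableSpace X] (m : MeasureTheory.Measure X)
    [MeasureTheory.SigmaFinite m] (E : DirichletParts.L2Form m) (hE : E.IsDirichletForm) :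
    -- the parts of `E` and of its approximations live on the same sets, hence in the same spaces
    ((∀ t : ℝ, 0 < t → (E.timeApprox t).consSpace =ᵐ[m] E.consSpace ∧
        (E.timeApprox t).dissSpace =ᵐ[m] E.dissSpace) ∧
      (∀ β : ℝ, 0 < β → (E.yosidaApprox β).consSpace =ᵐ[m] E.consSpace ∧
        (E.yosidaApprox β).dissSpace =ᵐ[m] E.dissSpace)) ∧
    -- Mosco convergence as `t → 0`
    (∀ t : ℕ → ℝ, (∀ n, 0 < t n) → Tendsto t atTop (𝓝 0) →
      DirichletParts.MoscoConverges (fun n => (E.timeApprox (t n)).consPart) E.consPart ∧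
      DirichletParts.MoscoConverges (fun n => (E.timeApprox (t n)).dissPart) E.dissPart) ∧
    -- Mosco convergence as `β → ∞`
    (∀ β : ℕ → ℝ, (∀ n, 0 < β n) → Tendsto β atTop atTop →
      DirichletParts.MoscoConverges (fun n => (E.yosidaApprox (β n)).consPart) E.consPart ∧
      DirichletParts.MoscoConverges (fun n => (E.yosidaApprox (β n)).dissPart) E.dissPart) := by
  have hC := hE.isClosedForm
  have ht : ∀ t : ℝ, 0 < t → (E.timeApprox t).consSpace =ᵐ[m] E.consSpace ∧
      (E.timeApprox t).dissSpace =ᵐ[m] E.dissSpace := fun t ht =>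
    ⟨hE.consSpace_timeApprox ht, (hE.consSpace_timeApprox ht).compl⟩
  have hβ : ∀ β : ℝ, 0 < β → (E.yosidaApprox β).consSpace =ᵐ[m] E.consSpace ∧
      (E.yosidaApprox β).dissSpace =ᵐ[m] E.dissSpace := fun β hβ =>
    ⟨hE.consSpace_yosidaApprox hβ, (hE.consSpace_yosidaApprox hβ).compl⟩
  refine ⟨⟨ht, hβ⟩, fun t ht0 hlim => ?_, fun β hβ0 hlim => ?_⟩
  -- A part depends on its set only up to null sets, so all parts may be taken on the sets of `E`,
  -- where Mosco convergence holds for any fixed `Y`.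
  · simp only [DirichletParts.L2Form.consPart, DirichletParts.L2Form.dissPart,
      fun n => DirichletParts.L2Form.part_congr (E := E.timeApprox (t n)) (ht _ (ht0 n)).1,
      fun n => DirichletParts.L2Form.part_congr (E := E.timeApprox (t n)) (ht _ (ht0 n)).2]
    exact ⟨hC.moscoConverges_part_timeApprox _ ht0 hlim,
      hC.moscoConverges_part_timeApprox _ ht0 hlim⟩
  · simp only [DirichletParts.L2Form.consPart, DirichletParts.L2Form.dissPart,
      fun n => DirichletParts.L2Form.part_congr (E := E.yosidaApprox (β n)) (hβ _ (hβ0 n)).1,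
      fun n => DirichletParts.L2Form.part_congr (E := E.yosidaApprox (β n)) (hβ _ (hβ0 n)).2]
    exact ⟨hC.moscoConverges_part_yosidaApprox _ hβ0 hlim,
      hC.moscoConverges_part_yosidaApprox _ hβ0 hlim⟩
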